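/- Let $M$ be a $C^\infty$ manifold of dimension $n>1$, let $T_0M=TM\setminus\{0\}$, and let $(x^i,y^i)$ denote the coordinates on $TM$ induced by local coordinates $(x^i)$ on $M$. Let $F:TM\to[0,\infty)$ be a Finsler metric, that is, a continuous function which is smooth on $T_0M$, satisfies $F(x,cy)=cF(x,y)$ for all $c>0$ and $(x,y)\in T_0M$, and whose metric tensor $g_{ij}=\tfrac12\frac{\partial^2F^2}{\partial y^i\partial y^j}$ is non-degenerate on $T_0M$. Let $G=y^i\frac{\partial}{\partial x^i}-2G^i\frac{\partial}{\partial y^i}$ be its geodesic spray, the unique vector field of this form on $T_0M$ with $$G\Big(\frac{\partial F^2}{\partial y^i}\Big)-\frac{\partial F^2}{\partial x^i}=0,\qquad\text{i.e. } G^i=\tfrac14 g^{il}\Big(y^k\frac{\partial^2F^2}{\partial x^k\partial y^l}-\frac{\partial F^2}{\partial x^l}\Big).$$ Put $N^i_j=\frac{\partial G^i}{\partial y^j}$, $\frac{\delta}{\delta x^i}=\frac{\partial}{\partial x^i}-N^j_i\frac{\partial}{\partial y^j}$, $R^i_{jk}=\frac{\delta N^i_j}{\delta x^k}-\frac{\delta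 N^i_k}{\delta x^j}$ and $R^i_{jkl}=\frac{\partial R^i_{kl}}{\partial y^j}$. The $\chi$-curvature is $\chi_j=-\tfrac12R^i_{ijk}y^k$ and the mean Berwald curvature is $E_{jk}=\tfrac12\frac{\partial^3G^i}{\partial y^i\partial y^j\partial y^k}$. Suppose that on $T_0M$ 1. the $\chi$-curvature vanishes, and 2. the matrix $(E_{ij})$ has rank $n-1$. Then $$\lambda=\frac{-1}{\det g}\begin{vmatrix}2FE_{ij}&\frac{\partial F}{\partial y^i}\\[1mm]\frac{\partial F}{\partial y^j}&0\end{vmatrix}$$ is a well-defined smooth function on $T_0M$ (independent of the choice of local coordinates) and a first integral of the geodesic spray, i.e. $G(\lambda)=0$ on $T_0M$. -/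

import Mathlib

open scoped Manifold ContDiff

noncomputable section

namespace Finsler

/-! ### Local formulas, in the coordinates `(x, y)` of an open subset of `ℝⁿ × ℝⁿ` -/

/-- The model space of an `n`-dimensional manifold. -/
abbrev Model (n : ℕ) : Type := EuclideanSpace ℝ (Fin n)

variable {n : ℕ}

/-- The partial derivative `∂f/∂xⁱ`. -/
def dX (i : Fin n) (f : Model n × Model n → ℝ) : Model n × Model n → ℝ :=
  fun p => fderiv ℝ f p (EuclideanSpace.single i 1, 0)

/-- The partial derivative `∂f/∂yⁱ`. -/
def dY (i : Fin n) (f : Model n × Model n → ℝ) : Model n × Model n → ℝ :=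
  fun p => fderiv ℝ f p (0, EuclideanSpace.single i 1)

/-- The metric tensor `g_{ij} = (1/2) ∂²F²/∂yⁱ∂yʲ`. -/
def metricTensor (F : Model n × Model n → ℝ) (p : Model n × Model n) :
    Matrix (Fin n) (Fin n) ℝ :=
  Matrix.of fun i j => (1 / 2) * dY i (dY j (fun q => F q ^ 2)) p

/-- The vector field `yᵏ ∂/∂xᵏ - 2 cᵏ ∂/∂yᵏ` with coefficients `cᵏ`, applied to a function. -/
def secondOrderField (c : Fin n → Model n × Model n → ℝ) (f : Model n × Model n → ℝ) :
    Model n × Model n → ℝ :=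
  fun p => ∑ k, p.2 k * dX k f p - 2 * ∑ k, c k p * dY k f p

/-- The coefficients of the geodesic spray,
`Gⁱ = (1/4) g^{li} (yᵏ ∂²F²/∂xᵏ∂yˡ - ∂F²/∂xˡ)`, where `g^{li}` is the inverse of the metric
tensor. By `eulerLagrange_iff` they are the unique solution of the Euler-Lagrange equation
`δ_G F² = 0`. -/
def sprayCoeff (F : Model n × Model n → ℝ) (i : Fin n) : Model n × Model n → ℝ :=
  fun p => (1 / 4) * ∑ l,
    (∑ k, p.2 k * dX k (dY l (fun q => F q ^ 2)) p - dX l (fun q => F q ^ 2) p)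
      * (metricTensor F p)⁻¹ l i

theorem eulerLagrange_iff (F : Model n × Model n → ℝ) (c : Fin n → Model n × Model n → ℝ)
    (p : Model n × Model n) (hg : (metricTensor F p).det ≠ 0) :
    (∀ i, secondOrderField c (dY i (fun q => F q ^ 2)) p - dX i (fun q => F q ^ 2) p = 0) ↔
      ∀ i, c i p = sprayCoeff F i p := by
  set g := metricTensor F p with hgdef
  have hu : IsUnit g.det := isUnit_iff_ne_zero.mpr hg
  set w : Fin n → ℝ := fun l =>
    ∑ k, p.2 k * dX k (dY l (fun q => F q ^ 2)) p - dX l (fun q => F q ^ 2) p with hw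
  set a : Fin n → ℝ := fun i => c i p with ha
  have hG : (fun i => sprayCoeff F i p) = Matrix.vecMul ((1 / 4 : ℝ) • w) g⁻¹ := by
    funext i
    simp only [sprayCoeff, Matrix.vecMul, dotProduct, Finset.mul_sum, Pi.smul_apply, smul_eq_mul,
      ← hgdef, hw]
    exact Finset.sum_congr rfl fun l _ => by ring
  have h1 : (∀ i, secondOrderField c (dY i (fun q => F q ^ 2)) p
      - dX i (fun q => F q ^ 2) p = 0) ↔ Matrix.vecMul a g = (1 / 4 : ℝ) • w := by
    rw [funext_iff]
    refine forall_congr' fun i => ?_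
    have h2 : Matrix.vecMul a g i
        = (1 / 2) * ∑ k, c k p * dY k (dY i (fun q => F q ^ 2)) p := by
      simp only [Matrix.vecMul, dotProduct, Finset.mul_sum, hgdef, metricTensor, Matrix.of_apply,
        ha]
      exact Finset.sum_congr rfl fun l _ => by ring
    rw [h2]
    simp only [secondOrderField, hw, Pi.smul_apply, smul_eq_mul]
    constructor <;> intro h <;> linarith
  rw [h1, ← funext_iff (f := fun i => c i p), hG]
  constructor
  · intro h
    rw [← h, Matrix.vecMul_vecMul, Matrix.mul_nonsing_inv _ hu, Matrix.vecMul_one]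
  · intro h
    change a = _ at h
    rw [h, Matrix.vecMul_vecMul, Matrix.nonsing_inv_mul _ hu, Matrix.vecMul_one]

/-- The geodesic spray `G = yᵏ ∂/∂xᵏ - 2 Gᵏ ∂/∂yᵏ` of `F`, applied to a function. -/
def spray (F : Model n × Model n → ℝ) (f : Model n × Model n → ℝ) : Model n × Model n → ℝ :=
  secondOrderField (sprayCoeff F) f

/-- The coefficients `Nⁱ_j = ∂Gⁱ/∂yʲ` of the canonical nonlinear connection. -/
def connectionCoeff (F : Model n × Model n → ℝ) (i j : Fin n) : Model n × Model n → ℝ :=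
  dY j (sprayCoeff F i)

/-- The horizontal derivative `δf/δxⁱ = ∂f/∂xⁱ - Nʲ_i ∂f/∂yʲ`. -/
def deltaX (F : Model n × Model n → ℝ) (i : Fin n) (f : Model n × Model n → ℝ) :
    Model n × Model n → ℝ :=
  fun p => dX i f p - ∑ j, connectionCoeff F j i p * dY j f p

/-- The curvature `Rⁱ_{jk} = δNⁱ_j/δxᵏ - δNⁱ_k/δxʲ` of the nonlinear connection. -/
def curvature (F : Model n × Model n → ℝ) (i j k : Fin n) : Model n × Model n → ℝ :=
  fun p => deltaX F k (connectionCoeff F i j) p - deltaX F j (connectionCoeff F i k) p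

/-- The Riemannian curvature `Rⁱ_{jkl} = ∂Rⁱ_{kl}/∂yʲ` of the Berwald connection. -/
def riemannCurvature (F : Model n × Model n → ℝ) (i j k l : Fin n) : Model n × Model n → ℝ :=
  dY j (curvature F i k l)

/-- The `χ`-curvature `χ_j = -(1/2) Rⁱ_{ijk} yᵏ`. -/
def chiCurvature (F : Model n × Model n → ℝ) (j : Fin n) : Model n × Model n → ℝ :=
  fun p => -(1 / 2) * ∑ i, ∑ k, riemannCurvature F i i j k p * p.2 k

/-- The Berwald curvature `Bⁱ_{jkl} = ∂³Gⁱ/∂yʲ∂yᵏ∂yˡ`. -/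
def berwaldCurvature (F : Model n × Model n → ℝ) (i j k l : Fin n) : Model n × Model n → ℝ :=
  dY j (dY k (dY l (sprayCoeff F i)))

/-- The mean Berwald curvature `E_{jk} = (1/2) Bⁱ_{ijk}`. -/
def meanBerwald (F : Model n × Model n → ℝ) (p : Model n × Model n) :
    Matrix (Fin n) (Fin n) ℝ :=
  Matrix.of fun j k => (1 / 2) * ∑ i, berwaldCurvature F i i j k p

/-- The bordered matrix with blocks `2 F E_{ij}`, `∂F/∂yⁱ`, `∂F/∂yʲ` and `0`. -/
def borderedMatrix (F : Model n × Model n → ℝ) (p : Model n × Model n) :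
    Matrix (Fin n ⊕ Unit) (Fin n ⊕ Unit) ℝ :=
  Matrix.fromBlocks ((2 * F p) • meanBerwald F p) (Matrix.of fun i _ => dY i F p)
    (Matrix.of fun _ j => dY j F p) 0

/-- The function `-(1 / det g) det [[2 F E_{ij}, ∂F/∂yⁱ], [∂F/∂yʲ, 0]]`. -/
def lambdaCoord (F : Model n × Model n → ℝ) : Model n × Model n → ℝ :=
  fun p => (-1 / (metricTensor F p).det) * (borderedMatrix F p).det

/-! ### Finsler manifolds -/

variable {M : Type*} [TopologicalSpace M] [ChartedSpace (Model n) M]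

/-- The expression `(x, y) ↦ f(x, y)` of a function `f` on `TM` in the coordinates `(xⁱ, yⁱ)`
which a chart `e` of `M` induces on `TM`: the pair `(x, y)` stands for the vector
`yⁱ ∂/∂xⁱ` at the point `e⁻¹(x)`. -/
def localRep (e : OpenPartialHomeomorph M (Model n)) (f : TangentBundle (𝓡 n) M → ℝ) :
    Model n × Model n → ℝ :=
  fun p => f (tangentMap (𝓡 n) (𝓡 n) e.symm ⟨p.1, p.2⟩)

/-- The relation `P` holds at all points of `T₀M`, in all induced coordinates: `P e p` is asked
for all smooth charts `e` and all coordinates `p = (x, y)`, `y ≠ 0`, of points of `T₀M` over the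
domain of `e`. -/
def InAllCoordinates (P : OpenPartialHomeomorph M (Model n) → Model n × Model n → Prop) : Prop :=
  ∀ e ∈ IsManifold.maximalAtlas (𝓡 n) ∞ M, ∀ x ∈ e.target, ∀ y : Model n, y ≠ 0 → P e (x, y)

/-- The tangent bundle `T₀M` with the zero section removed. -/
def slitTangentBundle (n : ℕ) (M : Type*) [TopologicalSpace M] [ChartedSpace (Model n) M] :
    Set (TangentBundle (𝓡 n) M) :=
  {v | v.2 ≠ 0}

/-- `F : TM → [0, ∞)` is a Finsler structure. -/
structure IsFinsler [IsManifold (𝓡 n) ∞ M] (F : TangentBundle (𝓡 n) M → ℝ) : Prop where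
  nonneg : ∀ v, 0 ≤ F v
  continuous : Continuous F
  smooth : ContMDiffOn (𝓡 n).tangent 𝓘(ℝ) ∞ F (slitTangentBundle n M)
  homogeneous : ∀ (x : M) (y : TangentSpace (𝓡 n) x), y ≠ 0 → ∀ c : ℝ, 0 < c →
    F ⟨x, c • y⟩ = c * F ⟨x, y⟩
  nondegenerate : InAllCoordinates (M := M) fun e p => (metricTensor (localRep e F) p).det ≠ 0

/-- `f` is a (smooth) first integral on `T₀M` of the geodesic spray `G` of `F`: `G(f) = 0`. -/
structure IsFirstIntegral [IsManifold (𝓡 n) ∞ M] (F f : TangentBundle (𝓡 n) M → ℝ) : Prop where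
  smooth : ContMDiffOn (𝓡 n).tangent 𝓘(ℝ) ∞ f (slitTangentBundle n M)
  spray_eq_zero : InAllCoordinates (M := M) fun e p =>
    spray (localRep e F) (localRep e f) p = 0

end Finsler

end

/-! In coordinates, write N for the matrix `Nⁱ_j` and call a field of bilinear forms A parallel if
`G(A) = Nᵀ A + A N`. Jacobi's formula then gives `G(det A) = 2 tr N · det A`, so the quotient of two
such determinants is a first integral wherever the denominator is nonzero. The theorem exhibits `λ`
as such a quotient.

Parallel forms come from Euler-Lagrange equations: if `G(∂f/∂yʲ) = ∂f/∂xʲ`, differentiating in `yᵏ`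
and symmetrizing in `j, k` shows that the vertical Hessian of `f` is parallel
(`secondOrderField_hessian`). With `f = F²` this gives `g`. With `f = Nⁱ_i` it gives `E`, because
`E` is half the vertical Hessian of `Nⁱ_i` (`meanBerwald_apply`) and the `χ`-curvature is `-1/2`
times the Euler-Lagrange expression of `Nⁱ_i` (`chiCurvature_eq`). Moreover `G(F) = 0` and
`G(∂F/∂yʲ) = Nᵏ_j ∂F/∂yᵏ`, so the bordered matrix is parallel for N extended by zero, which has the
same trace (`spray_lambdaCoord`).

For independence of the chart, let J be the Jacobian of a coordinate change. The spray coefficients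
pick up a term quadratic in `y`, so `Nⁱ_i` picks up a fibrewise linear one, which the vertical
Hessian kills. Hence `g` and `E` are tensors, `∂F/∂yⁱ` is a covector, and both determinants scale by
`(det J)²` (`lambdaCoord_tangentLift`). -/

noncomputable section

namespace Finsler

variable {n : ℕ}

/-! ### Directional derivatives of smooth functions on an open set -/

section DirDeriv

variable {V : Type*} [NormedAddCommGroup V] [NormedSpace ℝ V] {Ω : Set V} {f h : V → ℝ} {p : V}

/-- The derivative of `f` in the constant direction `u`. -/
def dirDeriv (u : V) (f : V → ℝ) : V → ℝ := fun p => fderiv ℝ f p u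

theorem differentiableAt_of_smooth (hΩ : IsOpen Ω) (hf : ContDiffOn ℝ ∞ f Ω) (hp : p ∈ Ω) :
    DifferentiableAt ℝ f p :=
  (hf.contDiffAt (hΩ.mem_nhds hp)).differentiableAt (by simp)

theorem contDiffOn_dirDeriv (hΩ : IsOpen Ω) (hf : ContDiffOn ℝ ∞ f Ω) (u : V) :
    ContDiffOn ℝ ∞ (dirDeriv u f) Ω :=
  (hf.fderiv_of_isOpen hΩ (m := ∞) (by simp)).clm_apply contDiffOn_const

theorem dirDeriv_congr (hΩ : IsOpen Ω) (hfh : ∀ q ∈ Ω, f q = h q) (hp : p ∈ Ω) (u : V) :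
    dirDeriv u f p = dirDeriv u h p := by
  have : f =ᶠ[nhds p] h := by
    filter_upwards [hΩ.mem_nhds hp] with q hq using hfh q hq
  simp only [dirDeriv, this.fderiv_eq]

theorem dirDeriv_comm (hΩ : IsOpen Ω) (hf : ContDiffOn ℝ ∞ f Ω) (hp : p ∈ Ω) (u v : V) :
    dirDeriv u (dirDeriv v f) p = dirDeriv v (dirDeriv u f) p := by
  have hfp := hf.contDiffAt (hΩ.mem_nhds hp)
  have hd : DifferentiableAt ℝ (fderiv ℝ f) p :=
    (hfp.fderiv_right (m := ∞) (by simp)).differentiableAt (by simp)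
  have key : ∀ a b : V, dirDeriv a (dirDeriv b f) p = fderiv ℝ (fderiv ℝ f) p a b := by
    intro a b
    have : dirDeriv b f = fun q => fderiv ℝ f q b := rfl
    rw [this, dirDeriv, fderiv_clm_apply hd (differentiableAt_const b)]
    simp
  rw [key, key]
  exact (hfp.isSymmSndFDerivAt (by
    rw [minSmoothness_of_isRCLikeNormedField]
    exact WithTop.coe_le_coe.2 (le_top : (2 : ℕ∞) ≤ ⊤))).eq u v

theorem dirDeriv_mul (hf : DifferentiableAt ℝ f p) (hh : DifferentiableAt ℝ h p) (u : V) :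
    dirDeriv u (fun q => f q * h q) p = dirDeriv u f p * h p + f p * dirDeriv u h p := by
  simp only [dirDeriv]
  rw [fderiv_fun_mul hf hh]
  simp
  ring

theorem dirDeriv_const_mul (hf : DifferentiableAt ℝ f p) (c : ℝ) (u : V) :
    dirDeriv u (fun q => c * f q) p = c * dirDeriv u f p := by
  simp only [dirDeriv]
  rw [fderiv_const_mul hf]
  simp

theorem dirDeriv_sub (hf : DifferentiableAt ℝ f p) (hh : DifferentiableAt ℝ h p) (u : V) :
    dirDeriv u (fun q => f q - h q) p = dirDeriv u f p - dirDeriv u h p := by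
  simp only [dirDeriv]
  rw [fderiv_fun_sub hf hh]
  simp

theorem dirDeriv_sum {ι : Type*} [Fintype ι] {f : ι → V → ℝ}
    (hf : ∀ i, DifferentiableAt ℝ (f i) p) (u : V) :
    dirDeriv u (fun q => ∑ i, f i q) p = ∑ i, dirDeriv u (f i) p := by
  simp only [dirDeriv]
  rw [fderiv_fun_sum fun i _ => hf i]
  simp

theorem dirDeriv_sum_mul {ι : Type*} [Fintype ι] {f h : ι → V → ℝ}
    (hf : ∀ i, DifferentiableAt ℝ (f i) p) (hh : ∀ i, DifferentiableAt ℝ (h i) p) (u : V) :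
    dirDeriv u (fun q => ∑ i, f i q * h i q) p
      = ∑ i, (dirDeriv u (f i) p * h i p + f i p * dirDeriv u (h i) p) := by
  rw [dirDeriv_sum fun i => (hf i).fun_mul (hh i)]
  exact Finset.sum_congr rfl fun i _ => dirDeriv_mul (hf i) (hh i) u

/-! ### Determinants of matrix functions and Jacobi's formula. -/

theorem contDiffOn_det {ι : Type*} [Fintype ι] [DecidableEq ι] {A : V → Matrix ι ι ℝ}
    (hA : ∀ i j, ContDiffOn ℝ ∞ (fun q => A q i j) Ω) :
    ContDiffOn ℝ ∞ (fun q => (A q).det) Ω := by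
  simp only [Matrix.det_apply']
  exact ContDiffOn.sum fun σ _ => contDiffOn_const.mul (contDiffOn_prod fun i _ => hA _ _)

theorem contDiffOn_inv_apply {ι : Type*} [Fintype ι] [DecidableEq ι] {A : V → Matrix ι ι ℝ}
    (hA : ∀ i j, ContDiffOn ℝ ∞ (fun q => A q i j) Ω) (hdet : ∀ q ∈ Ω, (A q).det ≠ 0) (i j : ι) :
    ContDiffOn ℝ ∞ (fun q => (A q)⁻¹ i j) Ω := by
  have h1 : ContDiffOn ℝ ∞ (fun q => (A q).adjugate i j) Ω := by
    simp only [Matrix.adjugate_apply]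
    refine contDiffOn_det fun k l => ?_
    rcases eq_or_ne k j with rfl | hk
    · simp only [Matrix.updateRow_self]
      exact contDiffOn_const
    · simp only [Matrix.updateRow_ne hk]
      exact hA k l
  refine (((contDiffOn_det hA).inv hdet).mul h1).congr fun q _ => ?_
  simp [Matrix.inv_def]

/-- The derivative of the determinant at `A` in the direction `X`. -/
def detDeriv {ι : Type*} [Fintype ι] [DecidableEq ι] (A X : Matrix ι ι ℝ) : ℝ :=
  ∑ σ : Equiv.Perm ι, (σ.sign : ℤ) * ∑ i, (∏ j ∈ Finset.univ.erase i, A (σ j) j) * X (σ i) i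

theorem detDeriv_add {ι : Type*} [Fintype ι] [DecidableEq ι] (A X Y : Matrix ι ι ℝ) :
    detDeriv A (X + Y) = detDeriv A X + detDeriv A Y := by
  simp only [detDeriv, Matrix.add_apply, mul_add, Finset.sum_add_distrib]

theorem hasDerivAt_det {ι : Type*} [Fintype ι] [DecidableEq ι] {A : ℝ → Matrix ι ι ℝ}
    {X : Matrix ι ι ℝ} {t : ℝ} (h : ∀ i j, HasDerivAt (fun s => A s i j) (X i j) t) :
    HasDerivAt (fun s => (A s).det) (detDeriv (A t) X) t := by
  simp only [Matrix.det_apply', detDeriv]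
  refine HasDerivAt.fun_sum fun σ _ => HasDerivAt.const_mul _ ?_
  simpa using HasDerivAt.fun_finsetProd (u := Finset.univ) fun i _ => h (σ i) i

theorem hasDerivAt_det_one_add {ι : Type*} [Fintype ι] [DecidableEq ι] (X : Matrix ι ι ℝ) :
    HasDerivAt (fun t : ℝ => (1 + t • X).det) X.trace 0 := by
  have h1 := (Matrix.det (1 + (Polynomial.X : Polynomial ℝ) • X.map Polynomial.C)).hasDerivAt 0
  rw [Matrix.derivative_det_one_add_X_smul X] at h1
  refine h1.congr_of_eventuallyEq (Filter.Eventually.of_forall fun t => ?_)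
  change (1 + t • X).det = Polynomial.eval t _
  rw [← Polynomial.coe_evalRingHom, RingHom.map_det]
  congr 1
  ext i j
  by_cases hij : i = j <;> simp [hij, mul_comm t]

/-- Differentiate `det (A (1 + tN)) = det A · det (1 + tN)` at `t = 0`. No inverse of `A` enters, so
singular `A` is allowed. -/
theorem detDeriv_mul_right {ι : Type*} [Fintype ι] [DecidableEq ι] (A N : Matrix ι ι ℝ) :
    detDeriv A (A * N) = N.trace * A.det := by
  have h1 : HasDerivAt (fun t : ℝ => (A * (1 + t • N)).det)
      (detDeriv (A * (1 + (0 : ℝ) • N)) (A * N)) 0 := by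
    refine hasDerivAt_det (A := fun t : ℝ => A * (1 + t • N)) fun i j => ?_
    simpa [mul_add] using
      ((hasDerivAt_id (0 : ℝ)).mul_const ((A * N) i j)).const_add (A i j)
  have h2 := (hasDerivAt_det_one_add N).const_mul A.det
  simp only [Matrix.det_mul] at h1
  have := h1.unique h2
  simp only [zero_smul, add_zero, mul_one] at this
  rw [this, mul_comm]

theorem detDeriv_mul_left {ι : Type*} [Fintype ι] [DecidableEq ι] (A N : Matrix ι ι ℝ) :
    detDeriv A (N * A) = N.trace * A.det := by
  have h1 : HasDerivAt (fun t : ℝ => ((1 + t • N) * A).det)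
      (detDeriv ((1 + (0 : ℝ) • N) * A) (N * A)) 0 := by
    refine hasDerivAt_det (A := fun t : ℝ => (1 + t • N) * A) fun i j => ?_
    simpa [add_mul] using
      ((hasDerivAt_id (0 : ℝ)).mul_const ((N * A) i j)).const_add (A i j)
  have h2 := (hasDerivAt_det_one_add N).mul_const A.det
  simp only [Matrix.det_mul] at h1
  have := h1.unique h2
  simpa only [zero_smul, add_zero, one_mul] using this

/-- The derivative of the determinant of a matrix function `A` with `∂ᵤA = Nᵀ A + A N`. -/
theorem dirDeriv_det {ι : Type*} [Fintype ι] [DecidableEq ι] {A : V → Matrix ι ι ℝ}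
    (hA : ∀ i j, DifferentiableAt ℝ (fun q => A q i j) p)
    (hdet : DifferentiableAt ℝ (fun q => (A q).det) p) (N : Matrix ι ι ℝ) (u : V)
    (h : ∀ i j, dirDeriv u (fun q => A q i j) p = (N.transpose * A p + A p * N) i j) :
    dirDeriv u (fun q => (A q).det) p = 2 * N.trace * (A p).det := by
  have h1 : HasDerivAt (fun t : ℝ => (A (p + t • u)).det)
      (detDeriv (A (p + (0 : ℝ) • u)) (N.transpose * A p + A p * N)) 0 := by
    refine hasDerivAt_det (A := fun t : ℝ => A (p + t • u)) fun i j => ?_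
    rw [← h i j]
    exact (hA i j).hasFDerivAt.hasLineDerivAt u
  have h2 : HasDerivAt (fun t : ℝ => (A (p + t • u)).det) (dirDeriv u (fun q => (A q).det) p) 0 :=
    hdet.hasFDerivAt.hasLineDerivAt u
  rw [h2.unique h1, zero_smul, add_zero, detDeriv_add, detDeriv_mul_left, detDeriv_mul_right,
    Matrix.trace_transpose]
  ring

end DirDeriv

/-! ### Vector fields `yᵏ ∂/∂xᵏ - 2 cᵏ ∂/∂yᵏ` -/

section SecondOrderField

/-- The coordinate direction of `∂/∂xⁱ`. -/
def xDir (i : Fin n) : Model n × Model n := (EuclideanSpace.single i 1, 0)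

/-- The coordinate direction of `∂/∂yⁱ`. -/
def yDir (i : Fin n) : Model n × Model n := (0, EuclideanSpace.single i 1)

theorem dX_eq_dirDeriv (i : Fin n) (f : Model n × Model n → ℝ) : dX i f = dirDeriv (xDir i) f := rfl

theorem dY_eq_dirDeriv (i : Fin n) (f : Model n × Model n → ℝ) : dY i f = dirDeriv (yDir i) f := rfl

/-- The fibre coordinate `yᵏ`. -/
def yCoord (k : Fin n) : Model n × Model n → ℝ := fun p => p.2 k

theorem contDiff_yCoord (k : Fin n) : ContDiff ℝ ∞ (yCoord k) := by
  unfold yCoord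
  fun_prop

theorem differentiableAt_yCoord (k : Fin n) (p : Model n × Model n) :
    DifferentiableAt ℝ (yCoord k) p :=
  (contDiff_yCoord k).differentiable (by simp) p

theorem dirDeriv_yCoord (u : Model n × Model n) (k : Fin n) (p : Model n × Model n) :
    dirDeriv u (yCoord k) p = u.2 k := by
  have : yCoord k = ⇑((EuclideanSpace.proj k : Model n →L[ℝ] ℝ).comp
      (ContinuousLinearMap.snd ℝ (Model n) (Model n))) := rfl
  rw [dirDeriv, this, ContinuousLinearMap.fderiv]
  rfl

theorem sum_smul_single (y : Model n) : ∑ k, y k • (EuclideanSpace.single k (1 : ℝ)) = y := by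
  ext i
  simp [Finset.sum_apply, Pi.single_apply]

theorem fderiv_apply_eq_sum (f : Model n × Model n → ℝ) (p : Model n × Model n) (a b : Model n) :
    fderiv ℝ f p (a, b) = ∑ k, a k * dX k f p + ∑ k, b k * dY k f p := by
  have : ((a, b) : Model n × Model n) = ∑ k, a k • xDir k + ∑ k, b k • yDir k := by
    apply Prod.ext
    · simp [xDir, yDir, Prod.fst_sum, sum_smul_single]
    · simp [xDir, yDir, Prod.snd_sum, sum_smul_single]
  rw [this, map_add, map_sum, map_sum]
  simp only [map_smul, smul_eq_mul]
  rfl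

/-- With the coefficients frozen at `p`, the field is differentiation in one fixed direction, so the
rules for `dirDeriv` apply to it at that point. -/
theorem secondOrderField_eq_dirDeriv (c : Fin n → Model n × Model n → ℝ)
    (f : Model n × Model n → ℝ) (p : Model n × Model n) :
    secondOrderField c f p = dirDeriv (p.2, -(2 : ℝ) • WithLp.toLp 2 fun k => c k p) f p := by
  rw [dirDeriv, fderiv_apply_eq_sum, secondOrderField, sub_eq_add_neg, Finset.mul_sum,
    ← Finset.sum_neg_distrib]
  congr 1
  refine Finset.sum_congr rfl fun k _ => ?_
  simp
  ring

variable {Ω : Set (Model n × Model n)} {c : Fin n → Model n × Model n → ℝ}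
  {f : Model n × Model n → ℝ} {p : Model n × Model n}

theorem contDiffOn_dX (hΩ : IsOpen Ω) (hf : ContDiffOn ℝ ∞ f Ω) (i : Fin n) :
    ContDiffOn ℝ ∞ (dX i f) Ω := contDiffOn_dirDeriv hΩ hf _

theorem contDiffOn_dY (hΩ : IsOpen Ω) (hf : ContDiffOn ℝ ∞ f Ω) (i : Fin n) :
    ContDiffOn ℝ ∞ (dY i f) Ω := contDiffOn_dirDeriv hΩ hf _

/-- The commutator of `∂/∂yʲ` with `yᵏ ∂/∂xᵏ - 2 cᵏ ∂/∂yᵏ`. -/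
theorem dY_secondOrderField (hΩ : IsOpen Ω) (hc : ∀ k, ContDiffOn ℝ ∞ (c k) Ω)
    (hf : ContDiffOn ℝ ∞ f Ω) (hp : p ∈ Ω) (j : Fin n) :
    dY j (secondOrderField c f) p = secondOrderField c (dY j f) p + dX j f p
      - 2 * ∑ k, dY j (c k) p * dY k f p := by
  have hX : ∀ k, DifferentiableAt ℝ (dX k f) p := fun k =>
    differentiableAt_of_smooth hΩ (contDiffOn_dX hΩ hf k) hp
  have hY : ∀ k, DifferentiableAt ℝ (dY k f) p := fun k =>
    differentiableAt_of_smooth hΩ (contDiffOn_dY hΩ hf k) hp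
  have hcd : ∀ k, DifferentiableAt ℝ (c k) p := fun k => differentiableAt_of_smooth hΩ (hc k) hp
  have e : secondOrderField c f
      = fun q => (∑ k, yCoord k q * dX k f q) - 2 * ∑ k, c k q * dY k f q := rfl
  have d1 : DifferentiableAt ℝ (fun q => ∑ k, yCoord k q * dX k f q) p :=
    DifferentiableAt.fun_sum fun k _ => (differentiableAt_yCoord k p).mul (hX k)
  have d2 : DifferentiableAt ℝ (fun q => ∑ k, c k q * dY k f q) p :=
    DifferentiableAt.fun_sum fun k _ => (hcd k).mul (hY k)
  rw [e, dY_eq_dirDeriv, dirDeriv_sub d1 (d2.const_mul 2), dirDeriv_const_mul d2,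
    dirDeriv_sum_mul (fun k => differentiableAt_yCoord k p) hX, dirDeriv_sum_mul hcd hY]
  simp only [dirDeriv_yCoord, Finset.sum_add_distrib, secondOrderField]
  have h1 : ∑ k, (yDir j : Model n × Model n).2 k * dX k f p = dX j f p := by
    simp [yDir]
  have h2 : ∀ k, dirDeriv (yDir j) (dX k f) p = dX k (dY j f) p := fun k =>
    dirDeriv_comm hΩ hf hp _ _
  have h3 : ∀ k, dirDeriv (yDir j) (dY k f) p = dY k (dY j f) p := fun k =>
    dirDeriv_comm hΩ hf hp _ _
  simp only [h1, h2, h3, yCoord]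
  simp only [dY_eq_dirDeriv]
  ring

/-- If `f` satisfies the Euler-Lagrange equation, then its vertical Hessian is parallel. -/
theorem secondOrderField_hessian (hΩ : IsOpen Ω) (hc : ∀ k, ContDiffOn ℝ ∞ (c k) Ω)
    (hf : ContDiffOn ℝ ∞ f Ω)
    (h : ∀ j, ∀ q ∈ Ω, secondOrderField c (dY j f) q = dX j f q) (hp : p ∈ Ω) (j k : Fin n) :
    secondOrderField c (dY j (dY k f)) p
      = ∑ l, dY j (c l) p * dY l (dY k f) p + ∑ l, dY j (dY l f) p * dY k (c l) p := by
  have key : ∀ a b, dY a (dX b f) p = secondOrderField c (dY a (dY b f)) p + dX a (dY b f) p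
      - 2 * ∑ l, dY a (c l) p * dY l (dY b f) p := by
    intro a b
    rw [← dY_secondOrderField hΩ hc (contDiffOn_dY hΩ hf b) hp a]
    exact (dirDeriv_congr hΩ (h b) hp _).symm
  -- Adding the relations for `(j, k)` and `(k, j)` cancels the mixed derivatives `∂²f/∂x∂y`.
  have h1 := key j k
  have h2 := key k j
  have e1 : dY j (dX k f) p = dX k (dY j f) p := dirDeriv_comm hΩ hf hp _ _
  have e2 : dY k (dX j f) p = dX j (dY k f) p := dirDeriv_comm hΩ hf hp _ _
  have e3 : secondOrderField c (dY k (dY j f)) p = secondOrderField c (dY j (dY k f)) p := by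
    rw [secondOrderField_eq_dirDeriv, secondOrderField_eq_dirDeriv]
    exact dirDeriv_congr hΩ (fun q hq => dirDeriv_comm hΩ hf hq _ _) hp _
  have e4 : ∑ l, dY j (dY l f) p * dY k (c l) p = ∑ l, dY k (c l) p * dY l (dY j f) p := by
    refine Finset.sum_congr rfl fun l _ => ?_
    rw [mul_comm]
    congr 1
    exact dirDeriv_comm hΩ hf hp _ _
  rw [e4]
  rw [e1] at h1
  rw [e2, e3] at h2
  linarith

/-- Differentiation of Euler's relation `yᵏ ∂f/∂yᵏ = m f`. -/
theorem euler_dY (hΩ : IsOpen Ω) (hf : ContDiffOn ℝ ∞ f Ω) {m : ℝ}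
    (h : ∀ q ∈ Ω, ∑ k, q.2 k * dY k f q = m * f q) (hp : p ∈ Ω) (j : Fin n) :
    ∑ k, p.2 k * dY k (dY j f) p = (m - 1) * dY j f p := by
  have hY : ∀ k, DifferentiableAt ℝ (dY k f) p := fun k =>
    differentiableAt_of_smooth hΩ (contDiffOn_dY hΩ hf k) hp
  have h1 := dirDeriv_congr hΩ (f := fun q => ∑ k, yCoord k q * dY k f q) h hp (yDir j)
  rw [dirDeriv_sum_mul (fun k => differentiableAt_yCoord k p) hY,
    dirDeriv_const_mul (differentiableAt_of_smooth hΩ hf hp)] at h1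
  simp only [dirDeriv_yCoord, Finset.sum_add_distrib] at h1
  have h2 : ∑ k, (yDir j : Model n × Model n).2 k * dY k f p = dY j f p := by
    simp [yDir]
  have h3 : ∀ k, dirDeriv (yDir j) (dY k f) p = dY k (dY j f) p := fun k =>
    dirDeriv_comm hΩ hf hp _ _
  rw [h2] at h1
  simp only [h3, yCoord] at h1
  rw [← dY_eq_dirDeriv] at h1
  linarith

/-- `∂/∂xʲ` commutes with the fibre Euler field, so the degree stays `m`, while `∂/∂yʲ` lowers it by
one. -/
theorem euler_dX (hΩ : IsOpen Ω) (hf : ContDiffOn ℝ ∞ f Ω) {m : ℝ}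
    (h : ∀ q ∈ Ω, ∑ k, q.2 k * dY k f q = m * f q) (hp : p ∈ Ω) (j : Fin n) :
    ∑ k, p.2 k * dY k (dX j f) p = m * dX j f p := by
  have hY : ∀ k, DifferentiableAt ℝ (dY k f) p := fun k =>
    differentiableAt_of_smooth hΩ (contDiffOn_dY hΩ hf k) hp
  have h1 := dirDeriv_congr hΩ (f := fun q => ∑ k, yCoord k q * dY k f q) h hp (xDir j)
  rw [dirDeriv_sum_mul (fun k => differentiableAt_yCoord k p) hY,
    dirDeriv_const_mul (differentiableAt_of_smooth hΩ hf hp)] at h1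
  simp only [dirDeriv_yCoord, Finset.sum_add_distrib] at h1
  have h2 : ∑ k, (xDir j : Model n × Model n).2 k * dY k f p = 0 := by
    simp [xDir]
  have h3 : ∀ k, dirDeriv (xDir j) (dY k f) p = dY k (dX j f) p := fun k =>
    dirDeriv_comm hΩ hf hp _ _
  rw [h2] at h1
  simp only [h3, yCoord] at h1
  rw [← dX_eq_dirDeriv] at h1
  linarith

end SecondOrderField

/-! ### Finsler functions in coordinates -/

/-- The nonzero tangent vectors over `U`. -/
def slitDomain (U : Set (Model n)) : Set (Model n × Model n) := {p | p.1 ∈ U ∧ p.2 ≠ 0}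

/-- A Finsler function on the nonzero tangent vectors over an open set `U`. -/
structure IsLocalFinsler (U : Set (Model n)) (F : Model n × Model n → ℝ) : Prop where
  isOpen : IsOpen U
  smooth : ContDiffOn ℝ ∞ F (slitDomain U)
  pos : ∀ p ∈ slitDomain U, 0 < F p
  euler : ∀ p ∈ slitDomain U, ∑ k, p.2 k * dY k F p = 1 * F p
  nondegenerate : ∀ p ∈ slitDomain U, (metricTensor F p).det ≠ 0

theorem isOpen_slitDomain {U : Set (Model n)} (hU : IsOpen U) : IsOpen (slitDomain U) :=
  (hU.preimage continuous_fst).inter (isOpen_compl_singleton.preimage continuous_snd)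

/-- The trace `Nⁱ_i` of the nonlinear connection. -/
def connectionTrace (F : Model n × Model n → ℝ) : Model n × Model n → ℝ :=
  fun p => ∑ i, dY i (sprayCoeff F i) p

namespace IsLocalFinsler

variable {U : Set (Model n)} {F : Model n × Model n → ℝ} {p : Model n × Model n}

theorem isOpen_domain (h : IsLocalFinsler U F) : IsOpen (slitDomain U) := isOpen_slitDomain h.isOpen

theorem smooth_sq (h : IsLocalFinsler U F) : ContDiffOn ℝ ∞ (fun q => F q ^ 2) (slitDomain U) :=
  h.smooth.pow 2

theorem contDiffOn_metricTensor (h : IsLocalFinsler U F) (i j : Fin n) :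
    ContDiffOn ℝ ∞ (fun q => metricTensor F q i j) (slitDomain U) :=
  contDiffOn_const.mul
    (contDiffOn_dY h.isOpen_domain (contDiffOn_dY h.isOpen_domain h.smooth_sq j) i)

theorem contDiffOn_sprayCoeff (h : IsLocalFinsler U F) (i : Fin n) :
    ContDiffOn ℝ ∞ (sprayCoeff F i) (slitDomain U) := by
  have hΩ := h.isOpen_domain
  refine contDiffOn_const.mul (ContDiffOn.sum fun l _ => ContDiffOn.mul (ContDiffOn.sub
    (ContDiffOn.sum fun k _ => ContDiffOn.mul ?_ ?_) ?_) ?_)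
  · exact (contDiff_yCoord k).contDiffOn
  · exact contDiffOn_dX hΩ (contDiffOn_dY hΩ h.smooth_sq l) k
  · exact contDiffOn_dX hΩ h.smooth_sq l
  · exact contDiffOn_inv_apply h.contDiffOn_metricTensor h.nondegenerate l i

/-! ### The Euler-Lagrange equations of `F²` and `F`, and conservation of `F`. -/

theorem eulerLagrange (h : IsLocalFinsler U F) (hp : p ∈ slitDomain U) (i : Fin n) :
    secondOrderField (sprayCoeff F) (dY i (fun q => F q ^ 2)) p = dX i (fun q => F q ^ 2) p :=
  sub_eq_zero.1 ((eulerLagrange_iff F (sprayCoeff F) p (h.nondegenerate p hp)).2 (fun _ => rfl) i)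

theorem dirDeriv_sq (h : IsLocalFinsler U F) (hp : p ∈ slitDomain U) (u : Model n × Model n) :
    dirDeriv u (fun q => F q ^ 2) p = 2 * F p * dirDeriv u F p := by
  have hd := differentiableAt_of_smooth h.isOpen_domain h.smooth hp
  have := dirDeriv_mul hd hd u
  simp only [pow_two, this]
  ring

theorem euler_sq (h : IsLocalFinsler U F) (hp : p ∈ slitDomain U) :
    ∑ k, p.2 k * dY k (fun q => F q ^ 2) p = 2 * F p ^ 2 := by
  have h1 := h.euler p hp
  have h2 : ∀ k, p.2 k * dY k (fun q => F q ^ 2) p = 2 * F p * (p.2 k * dY k F p) := by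
    intro k
    rw [dY_eq_dirDeriv, h.dirDeriv_sq hp, ← dY_eq_dirDeriv]
    ring
  rw [Finset.sum_congr rfl fun k _ => h2 k, ← Finset.mul_sum, h1]
  ring

/-- Conservation of energy. Applying `G` to Euler's relation `yᵏ ∂F²/∂yᵏ = 2F²`, with `G(yᵏ) = -2Gᵏ`
and the Euler-Lagrange equation, turns the left side into `G(F²)` itself; hence `G(F²) = 2 G(F²)`.
-/
theorem spray_sq (h : IsLocalFinsler U F) (hp : p ∈ slitDomain U) :
    secondOrderField (sprayCoeff F) (fun q => F q ^ 2) p = 0 := by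
  have hΩ := h.isOpen_domain
  have hY : ∀ k, DifferentiableAt ℝ (dY k (fun q => F q ^ 2)) p := fun k =>
    differentiableAt_of_smooth hΩ (contDiffOn_dY hΩ h.smooth_sq k) hp
  have h1 := dirDeriv_congr hΩ
    (f := fun q => ∑ k, yCoord k q * dY k (fun q => F q ^ 2) q) (fun q hq => h.euler_sq hq) hp
    (p.2, -(2 : ℝ) • WithLp.toLp 2 fun k => sprayCoeff F k p)
  rw [dirDeriv_sum_mul (fun k => differentiableAt_yCoord k p) hY,
    dirDeriv_const_mul (differentiableAt_of_smooth hΩ h.smooth_sq hp)] at h1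
  simp only [dirDeriv_yCoord, Finset.sum_add_distrib, ← secondOrderField_eq_dirDeriv,
    h.eulerLagrange hp] at h1
  have h2 : ∑ k, (-(2 : ℝ) • WithLp.toLp 2 fun k => sprayCoeff F k p : Model n) k
      * dY k (fun q => F q ^ 2) p
      = - (2 * ∑ k, sprayCoeff F k p * dY k (fun q => F q ^ 2) p) := by
    rw [Finset.mul_sum, ← Finset.sum_neg_distrib]
    refine Finset.sum_congr rfl fun k _ => ?_
    simp
    ring
  rw [h2] at h1
  have h3 : secondOrderField (sprayCoeff F) (fun q => F q ^ 2) p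
    = ∑ k, p.2 k * dX k (fun q => F q ^ 2) p
      - 2 * ∑ k, sprayCoeff F k p * dY k (fun q => F q ^ 2) p := rfl
  simp only [yCoord] at h1
  linarith

/-- The Finsler function is constant along its geodesics. -/
theorem spray_self (h : IsLocalFinsler U F) (hp : p ∈ slitDomain U) :
    secondOrderField (sprayCoeff F) F p = 0 := by
  have h1 := h.spray_sq hp
  rw [secondOrderField_eq_dirDeriv, h.dirDeriv_sq hp, ← secondOrderField_eq_dirDeriv] at h1
  have := (h.pos p hp).ne'
  simpa [this] using h1

/-- Because `G(F) = 0`, the Euler-Lagrange expression of `F²` is `2F` times that of `F`, and `F >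
0`. -/
theorem spray_dY_self_eq_dX (h : IsLocalFinsler U F) (hp : p ∈ slitDomain U) (j : Fin n) :
    secondOrderField (sprayCoeff F) (dY j F) p = dX j F p := by
  have hΩ := h.isOpen_domain
  have h1 := h.eulerLagrange hp j
  have hd := differentiableAt_of_smooth hΩ h.smooth hp
  have hY := differentiableAt_of_smooth hΩ (contDiffOn_dY hΩ h.smooth j) hp
  have h0 := h.spray_self hp
  rw [secondOrderField_eq_dirDeriv] at h1 h0 ⊢
  rw [dirDeriv_congr hΩ (f := dY j fun q => F q ^ 2) (h := fun q => 2 * F q * dY j F q)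
      (fun q hq => h.dirDeriv_sq hq _) hp,
    dirDeriv_mul (hd.const_mul 2) hY, dirDeriv_const_mul hd, h0, dX_eq_dirDeriv,
    h.dirDeriv_sq hp, ← dX_eq_dirDeriv] at h1
  have := (h.pos p hp).ne'
  have h2 : 2 * F p * (dirDeriv (p.2, -(2 : ℝ) • WithLp.toLp 2 fun k => sprayCoeff F k p)
    (dY j F) p - dX j F p) = 0 := by linarith
  have h3 : 2 * F p ≠ 0 := by positivity
  linarith [(mul_eq_zero.1 h2).resolve_left h3]

/-- Apply `∂/∂yʲ` to `G(F) = 0`: the commutator contributes `∂F/∂xʲ`, which equals `G(∂F/∂yʲ)`, so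
this term occurs twice and the factor `2` cancels. -/
theorem spray_dY_self (h : IsLocalFinsler U F) (hp : p ∈ slitDomain U) (j : Fin n) :
    secondOrderField (sprayCoeff F) (dY j F) p = ∑ k, dY j (sprayCoeff F k) p * dY k F p := by
  have hΩ := h.isOpen_domain
  have h1 := dY_secondOrderField hΩ h.contDiffOn_sprayCoeff h.smooth hp j
  have h2 : dY j (secondOrderField (sprayCoeff F) F) p = 0 := by
    rw [dY_eq_dirDeriv, dirDeriv_congr hΩ (h := fun _ => (0 : ℝ)) (fun q hq => h.spray_self hq) hp]
    simp [dirDeriv]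
  rw [h2, ← h.spray_dY_self_eq_dX hp j] at h1
  linarith

theorem sum_mul_dY (f : Model n × Model n → ℝ) (p : Model n × Model n) :
    ∑ k, p.2 k * dY k f p = dirDeriv (0, p.2) f p := by
  rw [dirDeriv, fderiv_apply_eq_sum]
  simp

/-- The spray coefficients are homogeneous of degree two. -/
theorem euler_sprayCoeff (h : IsLocalFinsler U F) (hp : p ∈ slitDomain U) (i : Fin n) :
    ∑ k, p.2 k * dY k (sprayCoeff F i) p = 2 * sprayCoeff F i p := by
  have hΩ := h.isOpen_domain
  set L : Model n × Model n → ℝ := fun q => F q ^ 2 with hL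
  have hLs : ContDiffOn ℝ ∞ L (slitDomain U) := h.smooth_sq
  have hLY := contDiffOn_dY hΩ hLs
  have eL : ∀ q ∈ slitDomain U, ∑ k, q.2 k * dY k L q = 2 * L q := fun q hq => h.euler_sq hq
  have eLY : ∀ l, ∀ q ∈ slitDomain U,
      ∑ k, q.2 k * dY k (dY l L) q = 1 * dY l L q := fun l q hq => by
    rw [euler_dY hΩ hLs eL hq]; norm_num
  have dc : ∀ k, DifferentiableAt ℝ (sprayCoeff F k) p := fun k =>
    differentiableAt_of_smooth hΩ (h.contDiffOn_sprayCoeff k) hp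
  -- `w` is the defect in Euler's relation. Differentiating the Euler-Lagrange equation along the
  -- fibre direction `y` and counting degrees gives `w g = 0`, and `g` is non-degenerate.
  set w : Fin n → ℝ := fun k => dirDeriv (0, p.2) (sprayCoeff F k) p - 2 * sprayCoeff F k p with hw
  suffices hw0 : w = 0 by
    rw [sum_mul_dY]
    exact sub_eq_zero.1 (congrFun hw0 i)
  refine Matrix.eq_zero_of_vecMul_eq_zero (h.nondegenerate p hp) ?_
  funext l
  have dXY : ∀ k, DifferentiableAt ℝ (dX k (dY l L)) p := fun k =>
    differentiableAt_of_smooth hΩ (contDiffOn_dX hΩ (hLY l) k) hp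
  have dYY : ∀ k, DifferentiableAt ℝ (dY k (dY l L)) p := fun k =>
    differentiableAt_of_smooth hΩ (contDiffOn_dY hΩ (hLY l) k) hp
  have d1 : DifferentiableAt ℝ (fun q => ∑ k, yCoord k q * dX k (dY l L) q) p :=
    DifferentiableAt.fun_sum fun k _ => (differentiableAt_yCoord k p).mul (dXY k)
  have d2 : DifferentiableAt ℝ (fun q => ∑ k, sprayCoeff F k q * dY k (dY l L) q) p :=
    DifferentiableAt.fun_sum fun k _ => (dc k).mul (dYY k)
  have h1 := dirDeriv_congr hΩ (f := fun q => (∑ k, yCoord k q * dX k (dY l L) q)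
    - 2 * ∑ k, sprayCoeff F k q * dY k (dY l L) q) (fun q hq => h.eulerLagrange hq l) hp (0, p.2)
  have h0 : (∑ k, yCoord k p * dX k (dY l L) p)
    - 2 * ∑ k, sprayCoeff F k p * dY k (dY l L) p = dX l L p := h.eulerLagrange hp l
  rw [dirDeriv_sub d1 (d2.const_mul 2), dirDeriv_const_mul d2,
    dirDeriv_sum_mul (fun k => differentiableAt_yCoord k p) dXY, dirDeriv_sum_mul dc dYY] at h1
  have e1 : ∀ k, dirDeriv (0, p.2) (dX k (dY l L)) p = dX k (dY l L) p := fun k => by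
    rw [← sum_mul_dY, euler_dX hΩ (hLY l) (eLY l) hp, one_mul]
  have e2 : ∀ k, dirDeriv (0, p.2) (dY k (dY l L)) p = 0 := fun k => by
    rw [← sum_mul_dY, euler_dY hΩ (hLY l) (eLY l) hp]; norm_num
  have e3 : dirDeriv (0, p.2) (dX l L) p = 2 * dX l L p := by
    rw [← sum_mul_dY, euler_dX hΩ hLs eL hp]
  simp only [dirDeriv_yCoord, e1, e2, mul_zero, add_zero, Finset.sum_add_distrib] at h1
  have e4 := h1.trans e3
  have e5 : Matrix.vecMul w (metricTensor F p) l
      = (1 / 2) * (∑ k, dirDeriv (0, p.2) (sprayCoeff F k) p * dY k (dY l L) p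
        - 2 * ∑ k, sprayCoeff F k p * dY k (dY l L) p) := by
    simp only [Matrix.vecMul, dotProduct, Finset.mul_sum, ← Finset.sum_sub_distrib]
    refine Finset.sum_congr rfl fun k _ => ?_
    simp only [hw, metricTensor, Matrix.of_apply]
    ring
  rw [e5, Pi.zero_apply]
  simp only [yCoord] at e4 h0
  linarith

/-! ### The trace `Nⁱ_i`, the mean Berwald curvature and the `χ`-curvature. -/

theorem contDiffOn_connectionTrace (h : IsLocalFinsler U F) :
    ContDiffOn ℝ ∞ (connectionTrace F) (slitDomain U) :=
  ContDiffOn.sum fun i _ => contDiffOn_dY h.isOpen_domain (h.contDiffOn_sprayCoeff i) i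

theorem dirDeriv_connectionTrace (h : IsLocalFinsler U F) (hp : p ∈ slitDomain U)
    (u : Model n × Model n) :
    dirDeriv u (connectionTrace F) p = ∑ i, dirDeriv u (dY i (sprayCoeff F i)) p :=
  dirDeriv_sum (fun i => differentiableAt_of_smooth h.isOpen_domain
    (contDiffOn_dY h.isOpen_domain (h.contDiffOn_sprayCoeff i) i) hp) u

theorem euler_connectionTrace (h : IsLocalFinsler U F) (hp : p ∈ slitDomain U) :
    ∑ k, p.2 k * dY k (connectionTrace F) p = 1 * connectionTrace F p := by
  have hΩ := h.isOpen_domain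
  rw [sum_mul_dY, h.dirDeriv_connectionTrace hp, connectionTrace, Finset.mul_sum]
  refine Finset.sum_congr rfl fun i _ => ?_
  rw [← sum_mul_dY, euler_dY hΩ (h.contDiffOn_sprayCoeff i)
    (fun q hq => h.euler_sprayCoeff hq i) hp]
  norm_num

/-- The mean Berwald curvature is half of the vertical Hessian of `Nⁱ_i`. -/
theorem meanBerwald_apply (h : IsLocalFinsler U F) (hp : p ∈ slitDomain U) (j k : Fin n) :
    meanBerwald F p j k = (1 / 2) * dY j (dY k (connectionTrace F)) p := by
  have hΩ := h.isOpen_domain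
  have hc := h.contDiffOn_sprayCoeff
  have h1 : ∀ q ∈ slitDomain U,
      dY k (connectionTrace F) q = ∑ i, dY i (dY k (sprayCoeff F i)) q := fun q hq => by
    rw [dY_eq_dirDeriv, h.dirDeriv_connectionTrace hq]
    exact Finset.sum_congr rfl fun i _ => dirDeriv_comm hΩ (hc i) hq _ _
  have h2 : dY j (dY k (connectionTrace F)) p = ∑ i, dY i (dY j (dY k (sprayCoeff F i))) p := by
    rw [dY_eq_dirDeriv, dirDeriv_congr hΩ h1 hp, dirDeriv_sum fun i =>
      differentiableAt_of_smooth hΩ (contDiffOn_dY hΩ (contDiffOn_dY hΩ (hc i) k) i) hp]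
    exact Finset.sum_congr rfl fun i _ => dirDeriv_comm hΩ (contDiffOn_dY hΩ (hc i) k) hp _ _
  rw [h2]
  rfl

/-- The trace `Rⁱ_{ijk}` of the Riemannian curvature. -/
theorem sum_riemannCurvature (h : IsLocalFinsler U F) (hp : p ∈ slitDomain U) (j k : Fin n) :
    ∑ i, riemannCurvature F i i j k p = deltaX F k (dY j (connectionTrace F)) p
      - deltaX F j (dY k (connectionTrace F)) p := by
  have hΩ := h.isOpen_domain
  have hc := h.contDiffOn_sprayCoeff
  have hN : ∀ i j, ContDiffOn ℝ ∞ (connectionCoeff F i j) (slitDomain U) := fun i j =>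
    contDiffOn_dY hΩ (hc i) j
  have dN : ∀ i j, DifferentiableAt ℝ (connectionCoeff F i j) p := fun i j =>
    differentiableAt_of_smooth hΩ (hN i j) hp
  have dXN : ∀ i j k, DifferentiableAt ℝ (dX k (connectionCoeff F i j)) p := fun i j k =>
    differentiableAt_of_smooth hΩ (contDiffOn_dX hΩ (hN i j) k) hp
  have dYN : ∀ i j k, DifferentiableAt ℝ (dY k (connectionCoeff F i j)) p := fun i j k =>
    differentiableAt_of_smooth hΩ (contDiffOn_dY hΩ (hN i j) k) hp
  have trY : ∀ j, ∀ q ∈ slitDomain U,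
      dY j (connectionTrace F) q = ∑ i, dY i (connectionCoeff F i j) q := fun j q hq => by
    rw [dY_eq_dirDeriv, h.dirDeriv_connectionTrace hq]
    exact Finset.sum_congr rfl fun i _ => dirDeriv_comm hΩ (hc i) hq _ _
  have trD : ∀ (u : Model n × Model n) (j : Fin n), dirDeriv u (dY j (connectionTrace F)) p
      = ∑ i, dY i (dirDeriv u (connectionCoeff F i j)) p := fun u j => by
    rw [dirDeriv_congr hΩ (trY j) hp, dirDeriv_sum fun i => dYN i j i]
    exact Finset.sum_congr rfl fun i _ => dirDeriv_comm hΩ (hN i j) hp _ _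
  have dδ : ∀ i j k, DifferentiableAt ℝ (deltaX F k (connectionCoeff F i j)) p := fun i j k =>
    (dXN i j k).sub (DifferentiableAt.fun_sum fun m _ => (dN m k).mul (dYN i j m))
  have Yδ : ∀ i j k, dY i (deltaX F k (connectionCoeff F i j)) p
      = dY i (dX k (connectionCoeff F i j)) p
        - ∑ m, connectionCoeff F m k p * dY i (dY m (connectionCoeff F i j)) p
        - ∑ m, dY i (connectionCoeff F m k) p * dY m (connectionCoeff F i j) p := fun i j k => by
    have e : deltaX F k (connectionCoeff F i j) = fun q => dX k (connectionCoeff F i j) q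
      - ∑ m, connectionCoeff F m k q * dY m (connectionCoeff F i j) q := rfl
    rw [e, dY_eq_dirDeriv, dirDeriv_sub (dXN i j k)
      (DifferentiableAt.fun_sum fun m _ => (dN m k).fun_mul (dYN i j m)),
      dirDeriv_sum_mul (fun m => dN m k) (fun m => dYN i j m), Finset.sum_add_distrib]
    simp only [dY_eq_dirDeriv]
    ring
  have trδ : ∀ j k, deltaX F k (dY j (connectionTrace F)) p
      = ∑ i, dY i (dX k (connectionCoeff F i j)) p
        - ∑ i, ∑ m, connectionCoeff F m k p * dY i (dY m (connectionCoeff F i j)) p := by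
    intro j k
    rw [Finset.sum_comm]
    simp only [← Finset.mul_sum]
    have e1 := trD (xDir k) j
    have e2 := fun m => trD (yDir m) j
    simp only [← dX_eq_dirDeriv, ← dY_eq_dirDeriv] at e1 e2
    simp only [deltaX, e1, e2]
  -- Under the trace, the products of first derivatives of `N` are symmetric in `j, k`, so they drop
  -- out of the antisymmetric curvature.
  have swap : ∑ i, ∑ m, dY i (connectionCoeff F m k) p * dY m (connectionCoeff F i j) p
      = ∑ i, ∑ m, dY i (connectionCoeff F m j) p * dY m (connectionCoeff F i k) p := by
    rw [Finset.sum_comm]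
    exact Finset.sum_congr rfl fun i _ => Finset.sum_congr rfl fun m _ => mul_comm _ _
  have hR : ∀ i, riemannCurvature F i i j k p = dY i (deltaX F k (connectionCoeff F i j)) p
      - dY i (deltaX F j (connectionCoeff F i k)) p := fun i =>
    dirDeriv_sub (dδ i j k) (dδ i k j) _
  simp only [hR, Yδ, trδ, Finset.sum_sub_distrib]
  rw [swap]
  ring

/-- The `χ`-curvature is the Euler-Lagrange derivative of `Nⁱ_i`, up to a factor. -/
theorem chiCurvature_eq (h : IsLocalFinsler U F) (hp : p ∈ slitDomain U) (j : Fin n) :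
    chiCurvature F j p = -(1 / 2) * (secondOrderField (sprayCoeff F) (dY j (connectionTrace F)) p
      - dX j (connectionTrace F) p) := by
  have hΩ := h.isOpen_domain
  have hN := h.contDiffOn_connectionTrace
  have eN : ∀ q ∈ slitDomain U, _ := fun q hq => h.euler_connectionTrace hq
  -- Homogeneity gives `yᵏ Nᵐ_k = 2Gᵐ`, so `yᵏ δ/δxᵏ` is the spray.
  have h1 : ∑ k, deltaX F k (dY j (connectionTrace F)) p * p.2 k
      = secondOrderField (sprayCoeff F) (dY j (connectionTrace F)) p := by
    simp only [deltaX, sub_mul, Finset.sum_sub_distrib, secondOrderField]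
    congr 1
    · exact Finset.sum_congr rfl fun k _ => mul_comm _ _
    · simp only [Finset.sum_mul]
      rw [Finset.sum_comm, Finset.mul_sum]
      refine Finset.sum_congr rfl fun m _ => ?_
      rw [← mul_assoc, ← h.euler_sprayCoeff hp m, Finset.sum_mul]
      refine Finset.sum_congr rfl fun k _ => ?_
      simp only [connectionCoeff]
      ring
  -- `Nⁱ_i` has degree one, so its vertical Hessian annihilates `y` and only the `x`-derivative
  -- survives.
  have h2 : ∑ k, deltaX F j (dY k (connectionTrace F)) p * p.2 k = dX j (connectionTrace F) p := by
    have e1 := euler_dX hΩ hN eN hp j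
    have e2 := fun m => euler_dY hΩ hN eN hp m
    simp only [deltaX, sub_mul, Finset.sum_sub_distrib, Finset.sum_mul]
    rw [Finset.sum_comm (f := fun k m => connectionCoeff F m j p
      * dY m (dY k (connectionTrace F)) p * p.2 k)]
    have e3 : ∀ m,
        ∑ k, connectionCoeff F m j p * dY m (dY k (connectionTrace F)) p * p.2 k = 0 := by
      intro m
      have : ∑ k, connectionCoeff F m j p * dY m (dY k (connectionTrace F)) p * p.2 k
          = connectionCoeff F m j p * ∑ k, p.2 k * dY k (dY m (connectionTrace F)) p := by
        rw [Finset.mul_sum]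
        refine Finset.sum_congr rfl fun k _ => ?_
        rw [show dY m (dY k (connectionTrace F)) p = dY k (dY m (connectionTrace F)) p from
          dirDeriv_comm hΩ hN hp _ _]
        ring
      rw [this, e2]
      ring
    simp only [e3, Finset.sum_const_zero, sub_zero]
    rw [one_mul] at e1
    rw [← e1]
    refine Finset.sum_congr rfl fun k _ => ?_
    rw [mul_comm]
    congr 1
    exact dirDeriv_comm hΩ hN hp _ _
  rw [chiCurvature, Finset.sum_comm]
  simp only [← Finset.sum_mul, h.sum_riemannCurvature hp, sub_mul, Finset.sum_sub_distrib, h1, h2]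

end IsLocalFinsler

/-! ### The first integral in coordinates -/

/-- The matrix `Nⁱ_j` of the nonlinear connection. -/
def connectionMatrix (F : Model n × Model n → ℝ) (p : Model n × Model n) :
    Matrix (Fin n) (Fin n) ℝ :=
  Matrix.of fun i j => dY j (sprayCoeff F i) p

/-- The direction of the geodesic spray at `p`. -/
def sprayDir (F : Model n × Model n → ℝ) (p : Model n × Model n) :
    Model n × Model n :=
  (p.2, -(2 : ℝ) • WithLp.toLp 2 fun k => sprayCoeff F k p)

/-- The connection matrix, extended by zero to the bordered index set. -/
def borderedConnection (F : Model n × Model n → ℝ) (p : Model n × Model n) :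
    Matrix (Fin n ⊕ Unit) (Fin n ⊕ Unit) ℝ :=
  Matrix.fromBlocks (connectionMatrix F p) 0 0 0

namespace IsLocalFinsler

variable {U : Set (Model n)} {F : Model n × Model n → ℝ} {p : Model n × Model n}

theorem contDiffOn_meanBerwald (h : IsLocalFinsler U F) (i j : Fin n) :
    ContDiffOn ℝ ∞ (fun q => meanBerwald F q i j) (slitDomain U) :=
  have hΩ := h.isOpen_domain
  (contDiffOn_const.mul
    (contDiffOn_dY hΩ (contDiffOn_dY hΩ h.contDiffOn_connectionTrace j) i)).congr
    fun _ hq => h.meanBerwald_apply hq i j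

theorem contDiffOn_borderedMatrix (h : IsLocalFinsler U F) (i j : Fin n ⊕ Unit) :
    ContDiffOn ℝ ∞ (fun q => borderedMatrix F q i j) (slitDomain U) := by
  have hΩ := h.isOpen_domain
  rcases i with i | i <;> rcases j with j | j
  · exact (contDiffOn_const.mul h.smooth).mul (h.contDiffOn_meanBerwald i j)
  · exact contDiffOn_dY hΩ h.smooth i
  · exact contDiffOn_dY hΩ h.smooth j
  · exact contDiffOn_const

theorem contDiffOn_lambdaCoord (h : IsLocalFinsler U F) :
    ContDiffOn ℝ ∞ (lambdaCoord F) (slitDomain U) :=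
  (contDiffOn_const.div (contDiffOn_det h.contDiffOn_metricTensor) h.nondegenerate).mul
    (contDiffOn_det h.contDiffOn_borderedMatrix)

/-- The metric tensor is parallel along geodesics. -/
theorem dirDeriv_metricTensor (h : IsLocalFinsler U F) (hp : p ∈ slitDomain U) (i j : Fin n) :
    dirDeriv (sprayDir F p) (fun q => metricTensor F q i j) p
      = ((connectionMatrix F p).transpose * metricTensor F p
        + metricTensor F p * connectionMatrix F p) i j := by
  have hΩ := h.isOpen_domain
  have h1 := secondOrderField_hessian hΩ h.contDiffOn_sprayCoeff h.smooth_sq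
    (fun j q hq => h.eulerLagrange hq j) hp i j
  have hd := differentiableAt_of_smooth hΩ
    (contDiffOn_dY hΩ (contDiffOn_dY hΩ h.smooth_sq j) i) hp
  rw [secondOrderField_eq_dirDeriv] at h1
  simp only [metricTensor, Matrix.of_apply]
  rw [dirDeriv_const_mul hd, sprayDir, h1]
  simp only [Matrix.add_apply, Matrix.mul_apply, Matrix.transpose_apply, connectionMatrix,
    Matrix.of_apply, mul_add, Finset.mul_sum]
  congr 1 <;> exact Finset.sum_congr rfl fun l _ => by ring

/-- If the `χ`-curvature vanishes, the mean Berwald curvature is parallel along geodesics. -/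
theorem dirDeriv_meanBerwald (h : IsLocalFinsler U F)
    (hχ : ∀ q ∈ slitDomain U, ∀ j, chiCurvature F j q = 0) (hp : p ∈ slitDomain U)
    (i j : Fin n) :
    dirDeriv (sprayDir F p) (fun q => meanBerwald F q i j) p
      = ((connectionMatrix F p).transpose * meanBerwald F p
        + meanBerwald F p * connectionMatrix F p) i j := by
  have hΩ := h.isOpen_domain
  have hN := h.contDiffOn_connectionTrace
  have h1 := secondOrderField_hessian hΩ h.contDiffOn_sprayCoeff hN
    (fun j q hq => by
      have := h.chiCurvature_eq hq j
      rw [hχ q hq j] at this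
      linarith) hp i j
  have hd := differentiableAt_of_smooth hΩ (contDiffOn_dY hΩ (contDiffOn_dY hΩ hN j) i) hp
  rw [secondOrderField_eq_dirDeriv] at h1
  rw [dirDeriv_congr hΩ (fun q hq => h.meanBerwald_apply hq i j) hp, dirDeriv_const_mul hd,
    sprayDir, h1]
  simp only [Matrix.add_apply, Matrix.mul_apply, Matrix.transpose_apply, connectionMatrix,
    Matrix.of_apply, mul_add, Finset.mul_sum, h.meanBerwald_apply hp]
  congr 1 <;> exact Finset.sum_congr rfl fun l _ => by ring

/-- The factor `2F` is constant along `G`, and the border obeys `G(∂F/∂yʲ) = Nᵏ_j ∂F/∂yᵏ`. This is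
exactly what the extension of `N` by a zero row and column prescribes. -/
theorem dirDeriv_borderedMatrix (h : IsLocalFinsler U F)
    (hχ : ∀ q ∈ slitDomain U, ∀ j, chiCurvature F j q = 0) (hp : p ∈ slitDomain U)
    (i j : Fin n ⊕ Unit) :
    dirDeriv (sprayDir F p) (fun q => borderedMatrix F q i j) p
      = ((borderedConnection F p).transpose * borderedMatrix F p
        + borderedMatrix F p * borderedConnection F p) i j := by
  have hΩ := h.isOpen_domain
  have hF0 : dirDeriv (sprayDir F p) F p = 0 := by
    rw [sprayDir, ← secondOrderField_eq_dirDeriv, h.spray_self hp]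
  have hFY : ∀ j, dirDeriv (sprayDir F p) (dY j F) p
      = ∑ k, dY j (sprayCoeff F k) p * dY k F p := fun j => by
    rw [sprayDir, ← secondOrderField_eq_dirDeriv, h.spray_dY_self hp]
  have hFd := differentiableAt_of_smooth hΩ h.smooth hp
  have hb : borderedMatrix F p = Matrix.fromBlocks ((2 * F p) • meanBerwald F p)
    (Matrix.of fun i _ => dY i F p) (Matrix.of fun _ j => dY j F p) 0 := rfl
  rw [hb, borderedConnection, Matrix.fromBlocks_transpose, Matrix.fromBlocks_multiply,
    Matrix.fromBlocks_multiply, Matrix.fromBlocks_add]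
  rcases i with i | i <;> rcases j with j | j
  · have h1 := h.dirDeriv_meanBerwald hχ hp i j
    have h2 := dirDeriv_mul (hFd.const_mul 2)
      (differentiableAt_of_smooth hΩ (h.contDiffOn_meanBerwald i j) hp) (sprayDir F p)
    rw [dirDeriv_const_mul hFd, hF0, h1] at h2
    refine h2.trans ?_
    simp [Matrix.mul_smul, mul_add]
  · refine (hFY i).trans ?_
    simp [Matrix.mul_apply, connectionMatrix]
  · refine (hFY j).trans ?_
    simp [Matrix.mul_apply, connectionMatrix, mul_comm]
  · simp [borderedMatrix, dirDeriv]

/-- If the `χ`-curvature vanishes, then `λ` is constant along geodesics. -/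
theorem spray_lambdaCoord (h : IsLocalFinsler U F)
    (hχ : ∀ q ∈ slitDomain U, ∀ j, chiCurvature F j q = 0) (hp : p ∈ slitDomain U) :
    spray F (lambdaCoord F) p = 0 := by
  have hΩ := h.isOpen_domain
  have hg := contDiffOn_det h.contDiffOn_metricTensor
  have hB := contDiffOn_det h.contDiffOn_borderedMatrix
  have h1 := dirDeriv_det
    (fun i j => differentiableAt_of_smooth hΩ (h.contDiffOn_metricTensor i j) hp)
    (differentiableAt_of_smooth hΩ hg hp) _ _ (h.dirDeriv_metricTensor hp)
  have h2 := dirDeriv_det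
    (fun i j => differentiableAt_of_smooth hΩ (h.contDiffOn_borderedMatrix i j) hp)
    (differentiableAt_of_smooth hΩ hB hp) _ _ (h.dirDeriv_borderedMatrix hχ hp)
  -- Differentiating the product `λ det g` instead of a quotient leaves `G(λ) det g = 0`, since both
  -- determinants have the factor `2 tr N`.
  have hlam : ∀ q ∈ slitDomain U,
      lambdaCoord F q * (metricTensor F q).det = (-1) * (borderedMatrix F q).det := fun q hq => by
    have := h.nondegenerate q hq
    simp only [lambdaCoord]
    field_simp
  have h3 := dirDeriv_congr hΩ hlam hp (sprayDir F p)
  rw [dirDeriv_mul (differentiableAt_of_smooth hΩ h.contDiffOn_lambdaCoord hp)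
    (differentiableAt_of_smooth hΩ hg hp),
    dirDeriv_const_mul (differentiableAt_of_smooth hΩ hB hp), h1, h2] at h3
  have ht : (borderedConnection F p).trace
      = (connectionMatrix F p).trace := by
    simp [Matrix.trace, borderedConnection]
  rw [ht] at h3
  have h4 := hlam p hp
  have h5 : dirDeriv (sprayDir F p) (lambdaCoord F) p * (metricTensor F p).det = 0 := by
    linear_combination h3 - 2 * (connectionMatrix F p).trace * h4
  rw [spray, secondOrderField_eq_dirDeriv]
  exact (mul_eq_zero.1 h5).resolve_right (h.nondegenerate p hp)

end IsLocalFinsler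

/-! ### Changes of coordinates -/

/-- The change of coordinates `(x, y) ↦ (φ(x), dφₓ(y))` induced by `φ`. -/
def tangentLift (φ : Model n → Model n) (p : Model n × Model n) : Model n × Model n :=
  (φ p.1, fderiv ℝ φ p.1 p.2)

/-- The matrix of a linear map in the standard basis. -/
def coordMatrix (J : Model n →L[ℝ] Model n) : Matrix (Fin n) (Fin n) ℝ :=
  Matrix.of fun a j => J (EuclideanSpace.single j 1) a

theorem coordMatrix_mulVec (J : Model n →L[ℝ] Model n) (v : Model n) (a : Fin n) :
    ∑ j, coordMatrix J a j * v j = J v a := by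
  conv_rhs => rw [← sum_smul_single v]
  simp [coordMatrix, mul_comm]

theorem det_coordMatrix_ne_zero {J : Model n →L[ℝ] Model n} (hJ : Function.Injective J) :
    (coordMatrix J).det ≠ 0 := by
  intro h0
  obtain ⟨v, hv, hv0⟩ := Matrix.exists_mulVec_eq_zero_iff.2 h0
  apply hv
  have : J (WithLp.toLp 2 v) = 0 := by
    ext a
    rw [← coordMatrix_mulVec]
    exact congrFun hv0 a
  have h2 := hJ (this.trans (map_zero J).symm)
  simpa using congrArg WithLp.ofLp h2

section Fibre

variable {f f' : Model n × Model n → ℝ} {x x' y : Model n} {J : Model n →L[ℝ] Model n}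
  {q : Model n → ℝ}

/-- `q` is the inhomogeneous part of a transformation law on one fibre: quadratic for the spray
coefficients, linear for `Nⁱ_i`, zero for `F`. The law is needed only off zero, since `y ≠ 0` has a
neighbourhood there. -/
theorem fderiv_vertical (hf : DifferentiableAt ℝ f (x, y)) (hf' : DifferentiableAt ℝ f' (x', J y))
    (hq : DifferentiableAt ℝ q y) (hy : y ≠ 0)
    (h : ∀ z, z ≠ 0 → f (x, z) = f' (x', J z) + q z) (v : Model n) :
    fderiv ℝ f (x, y) (0, v) = fderiv ℝ f' (x', J y) (0, J v) + fderiv ℝ q y v := by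
  have h1 : HasFDerivAt (fun z => f (x, z))
      ((fderiv ℝ f (x, y)).comp (ContinuousLinearMap.inr ℝ (Model n) (Model n))) y :=
    hf.hasFDerivAt.comp y (hasFDerivAt_prodMk_right x y)
  have h2 : HasFDerivAt (fun z => f' (x', J z))
      ((fderiv ℝ f' (x', J y)).comp ((ContinuousLinearMap.inr ℝ (Model n) (Model n)).comp J)) y :=
    hf'.hasFDerivAt.comp y ((hasFDerivAt_prodMk_right x' (J y)).comp y J.hasFDerivAt)
  have h3 := (h2.add hq.hasFDerivAt).congr_of_eventuallyEq (f₁ := fun z => f (x, z)) (by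
    filter_upwards [isOpen_compl_singleton.mem_nhds hy] with z hz using h z hz)
  have := congrArg (fun T : Model n →L[ℝ] ℝ => T v) (h1.unique h3)
  simpa using this

theorem dY_vertical (hf : DifferentiableAt ℝ f (x, y)) (hf' : DifferentiableAt ℝ f' (x', J y))
    (hq : DifferentiableAt ℝ q y) (hy : y ≠ 0)
    (h : ∀ z, z ≠ 0 → f (x, z) = f' (x', J z) + q z) (j : Fin n) :
    dY j f (x, y) = ∑ a, coordMatrix J a j * dY a f' (x', J y)
      + fderiv ℝ q y (EuclideanSpace.single j 1) := by
  rw [dY, fderiv_vertical hf hf' hq hy h, fderiv_apply_eq_sum]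
  simp [coordMatrix]

/-- The vertical Hessian transforms as a tensor, also up to fibrewise linear terms. -/
theorem dY_dY_vertical {U U' : Set (Model n)} (hU : IsOpen U) (hU' : IsOpen U')
    (hx : x ∈ U) (hx' : x' ∈ U') (hJ : Function.Injective J)
    (hf : ContDiffOn ℝ ∞ f (slitDomain U)) (hf' : ContDiffOn ℝ ∞ f' (slitDomain U'))
    (l : Model n →L[ℝ] ℝ) (h : ∀ z, z ≠ 0 → f (x, z) = f' (x', J z) + l z) (hy : y ≠ 0)
    (i j : Fin n) :
    dY i (dY j f) (x, y) = ((coordMatrix J).transpose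
      * Matrix.of (fun a b => dY a (dY b f') (x', J y)) * coordMatrix J) i j := by
  have hΩ := isOpen_slitDomain hU
  have hΩ' := isOpen_slitDomain hU'
  have hz : ∀ z, z ≠ 0 → (x, z) ∈ slitDomain U := fun z hz => ⟨hx, hz⟩
  have hz' : ∀ z, z ≠ 0 → (x', J z) ∈ slitDomain U' := fun z hz =>
    ⟨hx', fun h0 => hz (hJ (h0.trans (map_zero J).symm))⟩
  -- One vertical derivative turns `l` into a constant; the next one removes it.
  have h1 : ∀ z, z ≠ 0 → dY j f (x, z) = (fun p => ∑ b, coordMatrix J b j * dY b f' p) (x', J z)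
      + (fun _ => l (EuclideanSpace.single j 1)) z := fun z hz0 => by
    rw [dY_vertical (differentiableAt_of_smooth hΩ hf (hz z hz0))
      (differentiableAt_of_smooth hΩ' hf' (hz' z hz0)) l.differentiableAt hz0 h, l.fderiv]
  have hd : ∀ b, DifferentiableAt ℝ (dY b f') (x', J y) := fun b =>
    differentiableAt_of_smooth hΩ' (contDiffOn_dY hΩ' hf' b) (hz' y hy)
  rw [dY_vertical (differentiableAt_of_smooth hΩ (contDiffOn_dY hΩ hf j) (hz y hy))
    (DifferentiableAt.fun_sum fun b _ => (hd b).const_mul _)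
    (differentiableAt_const _) hy h1]
  have h2 : ∀ a, dY a (fun p => ∑ b, coordMatrix J b j * dY b f' p) (x', J y)
      = ∑ b, coordMatrix J b j * dY a (dY b f') (x', J y) := fun a => by
    rw [dY_eq_dirDeriv, dirDeriv_sum fun b => (hd b).const_mul _]
    exact Finset.sum_congr rfl fun b _ => dirDeriv_const_mul (hd b) _ _
  rw [Matrix.mul_assoc]
  simp only [h2, Matrix.mul_apply, Matrix.transpose_apply, Matrix.of_apply]
  simp [mul_comm]

end Fibre

section TangentLift

variable {U U' : Set (Model n)} {φ : Model n → Model n} {F F' : Model n × Model n → ℝ}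
  {p : Model n × Model n}

theorem hasFDerivAt_fderiv (hU : IsOpen U) (hφ : ContDiffOn ℝ ∞ φ U) {x : Model n} (hx : x ∈ U) :
    HasFDerivAt (fderiv ℝ φ) (fderiv ℝ (fderiv ℝ φ) x) x :=
  (((hφ.contDiffAt (hU.mem_nhds hx)).fderiv_right (m := ∞) (by simp)).differentiableAt
    (by simp)).hasFDerivAt

theorem hasFDerivAt_tangentLift (hU : IsOpen U) (hφ : ContDiffOn ℝ ∞ φ U) (hp : p.1 ∈ U) :
    ∃ T : Model n × Model n →L[ℝ] Model n × Model n, HasFDerivAt (tangentLift φ) T p ∧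
      ∀ a b, T (a, b)
        = (fderiv ℝ φ p.1 a, fderiv ℝ (fderiv ℝ φ) p.1 a p.2 + fderiv ℝ φ p.1 b) := by
  have h1 : HasFDerivAt (fun q : Model n × Model n => φ q.1) _ p :=
    ((hφ.contDiffAt (hU.mem_nhds hp)).differentiableAt (by simp)).hasFDerivAt.comp p hasFDerivAt_fst
  have h2 : HasFDerivAt (fun q : Model n × Model n => fderiv ℝ φ q.1) _ p :=
    (hasFDerivAt_fderiv hU hφ hp).comp p hasFDerivAt_fst
  refine ⟨_, h1.prodMk (h2.clm_apply hasFDerivAt_snd), fun a b => ?_⟩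
  simp [add_comm]

theorem tangentLift_mem (hmaps : Set.MapsTo φ U U')
    (hinj : ∀ x ∈ U, Function.Injective (fderiv ℝ φ x)) (hp : p ∈ slitDomain U) :
    tangentLift φ p ∈ slitDomain U' :=
  ⟨hmaps hp.1, fun h0 => hp.2 (hinj _ hp.1 (h0.trans (map_zero _).symm))⟩

/-- The transformation rule of the spray coefficients. -/
theorem fderiv_sprayCoeff (hφ : ContDiffOn ℝ ∞ φ U) (hmaps : Set.MapsTo φ U U')
    (hinj : ∀ x ∈ U, Function.Injective (fderiv ℝ φ x)) (h : IsLocalFinsler U F)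
    (h' : IsLocalFinsler U' F') (hFF : ∀ q ∈ slitDomain U, F q = F' (tangentLift φ q))
    (hp : p ∈ slitDomain U) :
    fderiv ℝ φ p.1 (WithLp.toLp 2 fun i => sprayCoeff F i p)
      = (WithLp.toLp 2 fun i => sprayCoeff F' i (tangentLift φ p))
        + (1 / 2 : ℝ) • fderiv ℝ (fderiv ℝ φ) p.1 p.2 p.2 := by
  have hU := h.isOpen
  have hΩ := h.isOpen_domain
  have hΩ' := h'.isOpen_domain
  have hsurj : Function.Surjective (fderiv ℝ φ p.1) :=
    (LinearMap.injective_iff_surjective (f := (fderiv ℝ φ p.1 : Model n →ₗ[ℝ] Model n))).1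
      (hinj _ hp.1)
  -- `c` is the preimage under `dφ` of the asserted right-hand side. It remains to check that `c`
  -- solves the Euler-Lagrange equation of `F` at `p`, whose solution is unique.
  obtain ⟨c, hc⟩ := hsurj ((WithLp.toLp 2 fun i => sprayCoeff F' i (tangentLift φ p))
        + (1 / 2 : ℝ) • fderiv ℝ (fderiv ℝ φ) p.1 p.2 p.2)
  suffices hs : ∀ i, c i = sprayCoeff F i p by
    rw [← hc]
    congr 1
    ext i
    exact (hs i).symm
  refine (eulerLagrange_iff F (fun i _ => c i) p (h.nondegenerate p hp)).1 fun i => ?_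
  set L : Model n × Model n → ℝ := fun q => F q ^ 2
  set L' : Model n × Model n → ℝ := fun q => F' q ^ 2
  have hL' : ContDiffOn ℝ ∞ L' (slitDomain U') := h'.smooth_sq
  have hp' := tangentLift_mem hmaps hinj hp
  have hLd : ∀ q ∈ slitDomain U, ∀ a b, fderiv ℝ L q (a, b) = fderiv ℝ L' (tangentLift φ q)
      (fderiv ℝ φ q.1 a, fderiv ℝ (fderiv ℝ φ) q.1 a q.2 + fderiv ℝ φ q.1 b) := by
    intro q hq a b
    obtain ⟨T, hT, hTa⟩ := hasFDerivAt_tangentLift hU hφ hq.1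
    have h1 := (differentiableAt_of_smooth hΩ' hL'
      (tangentLift_mem hmaps hinj hq)).hasFDerivAt.comp q hT
    have h2 : L =ᶠ[nhds q] L' ∘ tangentLift φ := by
      filter_upwards [hΩ.mem_nhds hq] with r hr
      simp only [L, L', Function.comp, hFF r hr]
    rw [h2.fderiv_eq, h1.fderiv, ContinuousLinearMap.comp_apply, hTa]
  set e : Model n := EuclideanSpace.single i 1
  have hLY : ∀ q ∈ slitDomain U, dY i L q
      = fderiv ℝ L' (tangentLift φ q) ((0 : Model n), fderiv ℝ φ q.1 e) := fun q hq => by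
    rw [dY, hLd q hq]
    simp [e]
  obtain ⟨T, hT, hTa⟩ := hasFDerivAt_tangentLift hU hφ hp.1
  have hH : HasFDerivAt (fderiv ℝ L') (fderiv ℝ (fderiv ℝ L') (tangentLift φ p))
      (tangentLift φ p) :=
    (((hL'.contDiffAt (hΩ'.mem_nhds hp')).fderiv_right (m := ∞) (by simp)).differentiableAt
      (by simp)).hasFDerivAt
  have hJe : HasFDerivAt (fun q : Model n × Model n => ((0 : Model n), fderiv ℝ φ q.1 e)) _ p :=
    (hasFDerivAt_const (0 : Model n) p).prodMk
      (((hasFDerivAt_fderiv hU hφ hp.1).comp p hasFDerivAt_fst).clm_apply (hasFDerivAt_const e p))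
  have hD := ((hH.comp p hT).clm_apply hJe).fderiv
  -- The term `½ D²φ(y, y)` in `c` is chosen to cancel here: the differential of `tangentLift φ`
  -- carries the direction defined by `c` to the spray direction of `F'`.
  have hdir : T (p.2, -(2 : ℝ) • c) = sprayDir F' (tangentLift φ p) := by
    rw [hTa, map_smul, hc, sprayDir]
    refine Prod.ext rfl ?_
    simp only [smul_add, smul_smul]
    norm_num
  -- The Euler-Lagrange equation of `F'` is extended linearly from basis vectors, since the vector
  -- `dφ(e)` tested below need not be one.
  have hEL : ∀ v : Model n, fderiv ℝ (fderiv ℝ L') (tangentLift φ p) (sprayDir F' (tangentLift φ p))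
      ((0 : Model n), v) = fderiv ℝ L' (tangentLift φ p) (v, (0 : Model n)) := by
    have hbasis : ∀ a : Fin n, fderiv ℝ (fderiv ℝ L') (tangentLift φ p)
        (sprayDir F' (tangentLift φ p)) (yDir a) = fderiv ℝ L' (tangentLift φ p) (xDir a) := by
      intro a
      have h1 := h'.eulerLagrange hp' a
      rw [secondOrderField_eq_dirDeriv] at h1
      have h2 := (hH.clm_apply (hasFDerivAt_const (yDir a) (tangentLift φ p))).fderiv
      have h3 := congrArg
        (fun T : Model n × Model n →L[ℝ] ℝ => T (sprayDir F' (tangentLift φ p))) h2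
      refine Eq.trans ?_ h1
      refine Eq.trans ?_ h3.symm
      simp
    intro v
    have e1 : ((0 : Model n), v) = ∑ a, v a • yDir a := by
      apply Prod.ext
      · simp [yDir, Prod.fst_sum]
      · simp [yDir, Prod.snd_sum, sum_smul_single]
    have e2 : (v, (0 : Model n)) = ∑ a, v a • xDir a := by
      apply Prod.ext
      · simp [xDir, Prod.fst_sum, sum_smul_single]
      · simp [xDir, Prod.snd_sum]
    rw [e1, e2, map_sum, map_sum]
    simp only [map_smul, hbasis]
  -- Both sides of the equation contain a `D²φ` term, with `y` and `e` in opposite order.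
  have hsymm : fderiv ℝ (fderiv ℝ φ) p.1 p.2 e = fderiv ℝ (fderiv ℝ φ) p.1 e p.2 :=
    ((hφ.contDiffAt (hU.mem_nhds hp.1)).isSymmSndFDerivAt (by
      rw [minSmoothness_of_isRCLikeNormedField]
      exact WithTop.coe_le_coe.2 (le_top : (2 : ℕ∞) ≤ ⊤))).eq _ _
  rw [sub_eq_zero, secondOrderField_eq_dirDeriv, dirDeriv_congr hΩ hLY hp]
  have hX : dX i L p = fderiv ℝ L' (tangentLift φ p) (fderiv ℝ φ p.1 e, (0 : Model n))
      + fderiv ℝ L' (tangentLift φ p) ((0 : Model n), fderiv ℝ (fderiv ℝ φ) p.1 e p.2) := by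
    rw [dX, hLd p hp, ← map_add]
    simp [e]
  rw [hX, ← hEL, ← hdir, ← hsymm]
  refine (congrArg (fun T : Model n × Model n →L[ℝ] ℝ => T (p.2, -(2 : ℝ) • c)) hD).trans ?_
  simp [add_comm]

/-- The function `Nⁱ_i` is invariant up to fibrewise linear terms. -/
theorem connectionTrace_tangentLift (hφ : ContDiffOn ℝ ∞ φ U) (hmaps : Set.MapsTo φ U U')
    (hinj : ∀ x ∈ U, Function.Injective (fderiv ℝ φ x)) (h : IsLocalFinsler U F)
    (h' : IsLocalFinsler U' F') (hFF : ∀ q ∈ slitDomain U, F q = F' (tangentLift φ q))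
    {x : Model n} (hx : x ∈ U) :
    ∃ l : Model n →L[ℝ] ℝ, ∀ z, z ≠ 0 →
      connectionTrace F (x, z) = connectionTrace F' (φ x, fderiv ℝ φ x z) + l z := by
  set J := fderiv ℝ φ x with hJ
  set Q := fderiv ℝ (fderiv ℝ φ) x with hQ
  have hdet : IsUnit (coordMatrix J).det :=
    isUnit_iff_ne_zero.2 (det_coordMatrix_ne_zero (hinj x hx))
  have hQs : ∀ u v, Q u v = Q v u := fun u v =>
    ((hφ.contDiffAt (h.isOpen.mem_nhds hx)).isSymmSndFDerivAt (by
      rw [minSmoothness_of_isRCLikeNormedField]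
      exact WithTop.coe_le_coe.2 (le_top : (2 : ℕ∞) ≤ ⊤))).eq _ _
  -- Vertical derivative of the transformation law of the spray coefficients; by symmetry, `½ D²φ(z,
  -- z)` contributes `D²φ(z, ·)`.
  have key : ∀ z, z ≠ 0 → coordMatrix J * connectionMatrix F (x, z)
      = connectionMatrix F' (φ x, J z) * coordMatrix J + coordMatrix (Q z) := by
    intro z hz
    have hp : (x, z) ∈ slitDomain U := ⟨hx, hz⟩
    have hp' : (φ x, J z) ∈ slitDomain U' := tangentLift_mem hmaps hinj hp
    ext a j
    have hdc : ∀ i, DifferentiableAt ℝ (sprayCoeff F i) (x, z) := fun i =>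
      differentiableAt_of_smooth h.isOpen_domain (h.contDiffOn_sprayCoeff i) hp
    have hq : HasFDerivAt (fun w : Model n => (1 / 2 : ℝ) * Q w w a)
        ((1 / 2 : ℝ) • (EuclideanSpace.proj a : Model n →L[ℝ] ℝ).comp (Q z + Q.flip z)) z := by
      have h1 : HasFDerivAt (fun w : Model n => Q w w) (Q z + Q.flip z) z := by
        have := (Q.hasFDerivAt (x := z)).clm_apply (hasFDerivAt_id z)
        simpa using this
      exact ((EuclideanSpace.proj a : Model n →L[ℝ] ℝ).hasFDerivAt.comp z h1).const_mul (1 / 2)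
    have h1 := dY_vertical (f := fun p => ∑ i, coordMatrix J a i * sprayCoeff F i p)
      (f' := sprayCoeff F' a) (x := x) (x' := φ x) (J := J)
      (q := fun w => (1 / 2 : ℝ) * Q w w a)
      (DifferentiableAt.fun_sum fun i _ => (hdc i).const_mul _)
      (differentiableAt_of_smooth h'.isOpen_domain (h'.contDiffOn_sprayCoeff a) hp')
      hq.differentiableAt hz (fun w hw => by
        have h2 := congrArg (fun v : Model n => v a)
          (fderiv_sprayCoeff hφ hmaps hinj h h' hFF (p := (x, w)) ⟨hx, hw⟩)
        rw [← coordMatrix_mulVec] at h2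
        simpa [tangentLift] using h2) j
    rw [dY_eq_dirDeriv, dirDeriv_sum fun i => (hdc i).const_mul _, hq.fderiv] at h1
    simp only [dirDeriv_const_mul (hdc _)] at h1
    simp only [Matrix.mul_apply, Matrix.add_apply, connectionMatrix, Matrix.of_apply,
      dY_eq_dirDeriv]
    refine h1.trans ?_
    congr 1
    · exact Finset.sum_congr rfl fun i _ => mul_comm _ _
    · simp [coordMatrix, hQs _ z]
      ring
  -- Multiplying `key` by `J⁻¹` and taking traces leaves `tr (J⁻¹ D²φ(z, ·))` as the difference of
  -- the two traces, which is linear in `z`.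
  let l0 : Model n →ₗ[ℝ] ℝ :=
    { toFun := fun z => ((coordMatrix J)⁻¹ * coordMatrix (Q z)).trace
      map_add' := fun u v => by
        rw [← Matrix.trace_add, ← Matrix.mul_add]
        congr 2
        ext a j
        simp [coordMatrix]
      map_smul' := fun r u => by
        rw [RingHom.id_apply, ← Matrix.trace_smul, ← Matrix.mul_smul]
        congr 2
        ext a j
        simp [coordMatrix] }
  refine ⟨LinearMap.toContinuousLinearMap l0, fun z hz => ?_⟩
  have h1 := congrArg (fun A => ((coordMatrix J)⁻¹ * A).trace) (key z hz)
  simp only [Matrix.mul_add, Matrix.trace_add] at h1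
  rw [← Matrix.mul_assoc, Matrix.nonsing_inv_mul _ hdet, Matrix.one_mul, Matrix.trace_mul_comm,
    Matrix.mul_assoc, Matrix.mul_nonsing_inv _ hdet, Matrix.mul_one] at h1
  exact h1

/-- The function `λ` does not depend on the coordinates. -/
theorem lambdaCoord_tangentLift (hφ : ContDiffOn ℝ ∞ φ U) (hmaps : Set.MapsTo φ U U')
    (hinj : ∀ x ∈ U, Function.Injective (fderiv ℝ φ x)) (h : IsLocalFinsler U F)
    (h' : IsLocalFinsler U' F') (hFF : ∀ q ∈ slitDomain U, F q = F' (tangentLift φ q))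
    (hp : p ∈ slitDomain U) :
    lambdaCoord F p = lambdaCoord F' (tangentLift φ p) := by
  obtain ⟨x, y⟩ := p
  have hx : x ∈ U := hp.1
  have hy : y ≠ 0 := hp.2
  have hp' := tangentLift_mem hmaps hinj hp
  set J := fderiv ℝ φ x with hJ
  have hL : tangentLift φ (x, y) = (φ x, J y) := rfl
  rw [hL] at hp' ⊢
  have hJi : Function.Injective J := hinj x hx
  have hdet := det_coordMatrix_ne_zero hJi
  have hFz : ∀ z, z ≠ 0 → F (x, z) = F' (φ x, J z) + (0 : Model n →L[ℝ] ℝ) z := fun z hz => by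
    rw [hFF (x, z) ⟨hx, hz⟩]
    simp [tangentLift, hJ]
  have hFY : ∀ j, dY j F (x, y) = ∑ a, coordMatrix J a j * dY a F' (φ x, J y) := fun j => by
    rw [dY_vertical (differentiableAt_of_smooth h.isOpen_domain h.smooth hp)
      (differentiableAt_of_smooth h'.isOpen_domain h'.smooth hp')
      (0 : Model n →L[ℝ] ℝ).differentiableAt hy hFz]
    simp
  have hg : metricTensor F (x, y)
      = (coordMatrix J).transpose * metricTensor F' (φ x, J y) * coordMatrix J := by
    have h1 := dY_dY_vertical h.isOpen h'.isOpen hx (hmaps hx) hJi h.smooth_sq h'.smooth_sq 0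
      (fun z hz => by rw [hFz z hz]; simp) hy
    have h2 : metricTensor F' (φ x, J y)
        = (1 / 2 : ℝ) • Matrix.of fun a b => dY a (dY b fun q => F' q ^ 2) (φ x, J y) := rfl
    ext i j
    rw [h2, Matrix.mul_smul, Matrix.smul_mul, Matrix.smul_apply, ← h1 i j]
    rfl
  have hE : meanBerwald F (x, y)
      = (coordMatrix J).transpose * meanBerwald F' (φ x, J y) * coordMatrix J := by
    obtain ⟨l, hl⟩ := connectionTrace_tangentLift hφ hmaps hinj h h' hFF hx
    have h1 := dY_dY_vertical h.isOpen h'.isOpen hx (hmaps hx) hJi h.contDiffOn_connectionTrace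
      h'.contDiffOn_connectionTrace l hl hy
    have h2 : meanBerwald F' (φ x, J y)
        = (1 / 2 : ℝ) • Matrix.of fun a b => dY a (dY b (connectionTrace F')) (φ x, J y) := by
      ext a b
      exact h'.meanBerwald_apply hp' a b
    ext i j
    rw [h2, Matrix.mul_smul, Matrix.smul_mul, Matrix.smul_apply, ← h1 i j,
      h.meanBerwald_apply hp i j]
    rfl
  -- The block `1` leaves the border index alone, so `det B` acquires the same factor `(det J)²` as
  -- `det g`.
  have hB : borderedMatrix F (x, y)
      = (Matrix.fromBlocks (coordMatrix J) 0 0 (1 : Matrix Unit Unit ℝ)).transpose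
        * borderedMatrix F' (φ x, J y)
        * Matrix.fromBlocks (coordMatrix J) 0 0 (1 : Matrix Unit Unit ℝ) := by
    simp only [borderedMatrix]
    rw [Matrix.fromBlocks_transpose, Matrix.fromBlocks_multiply, Matrix.fromBlocks_multiply, hE]
    have hF : F (x, y) = F' (φ x, J y) := by simpa using hFz y hy
    rw [hF]
    congr 1
    · simp
    · ext i j
      simp [Matrix.mul_apply, hFY]
    · ext i j
      simp [Matrix.mul_apply, hFY, mul_comm]
    · simp
  have hg' := h'.nondegenerate _ hp'
  simp only [lambdaCoord]
  rw [hg, hB]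
  simp only [Matrix.det_mul, Matrix.det_transpose, Matrix.det_fromBlocks_zero₂₁, Matrix.det_one]
  field_simp

end TangentLift

/-! ### Restriction, and positivity from homogeneity and non-degeneracy. -/

theorem IsLocalFinsler.mono {U V : Set (Model n)} {F : Model n × Model n → ℝ}
    (h : IsLocalFinsler U F) (hV : IsOpen V) (hVU : V ⊆ U) : IsLocalFinsler V F :=
  have hsub : slitDomain V ⊆ slitDomain U := fun _ hp => ⟨hVU hp.1, hp.2⟩
  ⟨hV, h.smooth.mono hsub, fun p hp => h.pos p (hsub hp), fun p hp => h.euler p (hsub hp),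
    fun p hp => h.nondegenerate p (hsub hp)⟩

/-- A nonnegative, positively homogeneous function with non-degenerate metric tensor is a Finsler
function; in particular it is positive. -/
theorem IsLocalFinsler.of_homogeneous {U : Set (Model n)} {F : Model n × Model n → ℝ}
    (hU : IsOpen U) (hF : ContDiffOn ℝ ∞ F (slitDomain U)) (hnonneg : ∀ p, 0 ≤ F p)
    (hhom : ∀ x ∈ U, ∀ y, y ≠ 0 → ∀ c : ℝ, 0 < c → F (x, c • y) = c * F (x, y))
    (hdet : ∀ p ∈ slitDomain U, (metricTensor F p).det ≠ 0) : IsLocalFinsler U F := by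
  have hΩ := isOpen_slitDomain hU
  have heuler : ∀ p ∈ slitDomain U, ∑ k, p.2 k * dY k F p = 1 * F p := by
    rintro ⟨x, y⟩ ⟨hx, hy⟩
    have hd := differentiableAt_of_smooth hΩ hF (p := (x, y)) ⟨hx, hy⟩
    have h1 : HasDerivAt (fun t : ℝ => F (x, t • y)) (fderiv ℝ F (x, y) (0, y)) 1 := by
      have hc : HasDerivAt (fun t : ℝ => ((x, t • y) : Model n × Model n)) (0, y) 1 := by
        have := (hasDerivAt_id (1 : ℝ)).smul_const y
        simpa using (hasDerivAt_const (1 : ℝ) x).prodMk this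
      have hd' : HasFDerivAt F (fderiv ℝ F (x, y)) (x, (1 : ℝ) • y) := by
        rw [one_smul]
        exact hd.hasFDerivAt
      exact hd'.comp_hasDerivAt 1 hc
    have h2 : HasDerivAt (fun t : ℝ => F (x, t • y)) (1 * F (x, y)) 1 := by
      refine ((hasDerivAt_id (1 : ℝ)).mul_const (F (x, y))).congr_of_eventuallyEq ?_
      filter_upwards [lt_mem_nhds (zero_lt_one (α := ℝ))] with t ht using hhom x hx y hy t ht
    rw [h2.unique h1, fderiv_apply_eq_sum]
    simp
  refine ⟨hU, hF, fun p hp => (hnonneg p).lt_of_ne' fun h0 => ?_, heuler, hdet⟩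
  have hsq : ContDiffOn ℝ ∞ (fun q => F q ^ 2) (slitDomain U) := hF.pow 2
  have hdsq : ∀ q ∈ slitDomain U, ∀ k, dY k (fun q => F q ^ 2) q = 2 * F q * dY k F q := by
    intro q hq k
    have hd := differentiableAt_of_smooth hΩ hF hq
    have := dirDeriv_mul hd hd (yDir k)
    simp only [pow_two, dY_eq_dirDeriv, this]
    ring
  have hesq : ∀ q ∈ slitDomain U, ∑ k, q.2 k * dY k (fun q => F q ^ 2) q = 2 * F q ^ 2 := by
    intro q hq
    have h2 : ∀ k, q.2 k * dY k (fun q => F q ^ 2) q = 2 * F q * (q.2 k * dY k F q) := by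
      intro k
      rw [hdsq q hq]
      ring
    rw [Finset.sum_congr rfl fun k _ => h2 k, ← Finset.mul_sum, heuler q hq]
    ring
  -- By Euler's relation `yᵏ g_{kj} = ½ ∂F²/∂yʲ = F ∂F/∂yʲ`. At a zero of `F` this puts `y` in the
  -- kernel of `g`, forcing `y = 0`.
  have hzero : (fun k => p.2 k) = 0 := by
    refine Matrix.eq_zero_of_vecMul_eq_zero (hdet p hp) ?_
    funext j
    have h1 := euler_dY hΩ hsq hesq hp j
    rw [hdsq p hp, h0] at h1
    have h2 : Matrix.vecMul (fun k => p.2 k) (metricTensor F p) j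
        = (1 / 2) * ∑ k, p.2 k * dY k (dY j fun q => F q ^ 2) p := by
      simp only [Matrix.vecMul, dotProduct, metricTensor, Matrix.of_apply, Finset.mul_sum]
      exact Finset.sum_congr rfl fun k _ => by ring
    rw [h2, h1]
    simp
  apply hp.2
  ext k
  exact congrFun hzero k

/-! ### Induced coordinates on the tangent bundle -/

section Manifold

variable {M : Type*} [TopologicalSpace M] [ChartedSpace (Model n) M]

/-- The coordinates of a tangent vector induced by the chart `e`. -/
def chartCoords (e : OpenPartialHomeomorph M (Model n)) (v : TangentBundle (𝓡 n) M) :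
    Model n × Model n :=
  (e v.1, mfderiv (𝓡 n) (𝓡 n) e v.1 v.2)

/-- The tangent vector with given coordinates in the chart `e`. -/
def chartVector (e : OpenPartialHomeomorph M (Model n)) (p : Model n × Model n) :
    TangentBundle (𝓡 n) M :=
  ⟨e.symm p.1, mfderiv (𝓡 n) (𝓡 n) e.symm p.1 p.2⟩

theorem localRep_apply (e : OpenPartialHomeomorph M (Model n)) (f : TangentBundle (𝓡 n) M → ℝ)
    (p : Model n × Model n) : localRep e f p = f (chartVector e p) := rfl

/-- All tangent spaces are definitionally the model space, so the vector parts can be compared there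
without transport along `h1`. -/
theorem tangentBundle_ext {v w : TangentBundle (𝓡 n) M} (h1 : v.1 = w.1)
    (h2 : (v.2 : Model n) = w.2) : v = w := by
  obtain ⟨x, a⟩ := v
  obtain ⟨x', b⟩ := w
  obtain rfl : x = x' := h1
  obtain rfl : a = b := h2
  rfl

variable {e e' : OpenPartialHomeomorph M (Model n)}

theorem mdifferentiable_of_mem_maximalAtlas (he : e ∈ IsManifold.maximalAtlas (𝓡 n) ∞ M) :
    e.MDifferentiable (𝓡 n) (𝓡 n) :=
  ⟨(contMDiffOn_of_mem_maximalAtlas he).mdifferentiableOn (by simp),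
    (contMDiffOn_symm_of_mem_maximalAtlas he).mdifferentiableOn (by simp)⟩

theorem chartVector_chartCoords (he : e ∈ IsManifold.maximalAtlas (𝓡 n) ∞ M)
    {v : TangentBundle (𝓡 n) M} (hv : v.1 ∈ e.source) : chartVector e (chartCoords e v) = v :=
  tangentBundle_ext (e.left_inv hv) (congrArg (fun T : Model n →L[ℝ] Model n => T v.2)
    ((mdifferentiable_of_mem_maximalAtlas he).symm_comp_deriv hv))

theorem chartCoords_chartVector (he : e ∈ IsManifold.maximalAtlas (𝓡 n) ∞ M)
    {p : Model n × Model n} (hp : p.1 ∈ e.target) : chartCoords e (chartVector e p) = p :=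
  Prod.ext (e.right_inv hp) (congrArg (fun T : Model n →L[ℝ] Model n => T p.2)
    ((mdifferentiable_of_mem_maximalAtlas he).comp_symm_deriv hp))

theorem chartCoords_mem (he : e ∈ IsManifold.maximalAtlas (𝓡 n) ∞ M)
    {v : TangentBundle (𝓡 n) M} (hv : v.1 ∈ e.source) (hv0 : v.2 ≠ 0) :
    chartCoords e v ∈ slitDomain e.target :=
  ⟨e.map_source hv, fun h0 => hv0 ((mdifferentiable_of_mem_maximalAtlas he).mfderiv_injective hv
    (h0.trans (map_zero _).symm))⟩

theorem chartVector_mem (he : e ∈ IsManifold.maximalAtlas (𝓡 n) ∞ M)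
    {p : Model n × Model n} (hp : p ∈ slitDomain e.target) :
    chartVector e p ∈ slitTangentBundle n M :=
  fun h0 => hp.2 ((mdifferentiable_of_mem_maximalAtlas he).symm.mfderiv_injective hp.1
    (h0.trans (map_zero _).symm))

theorem fderiv_chartChange (he : e ∈ IsManifold.maximalAtlas (𝓡 n) ∞ M)
    (he' : e' ∈ IsManifold.maximalAtlas (𝓡 n) ∞ M) {x : Model n} (hx : x ∈ e.target)
    (hx' : e.symm x ∈ e'.source) :
    fderiv ℝ (e' ∘ e.symm) x
      = ContinuousLinearMap.comp (mfderiv (𝓡 n) (𝓡 n) e' (e.symm x) : Model n →L[ℝ] Model n)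
        (mfderiv (𝓡 n) (𝓡 n) e.symm x : Model n →L[ℝ] Model n) := by
  rw [← mfderiv_eq_fderiv]
  exact mfderiv_comp x ((mdifferentiable_of_mem_maximalAtlas he').mdifferentiableAt hx')
    ((mdifferentiable_of_mem_maximalAtlas he).mdifferentiableAt_symm hx)

theorem tangentLift_chartChange (he : e ∈ IsManifold.maximalAtlas (𝓡 n) ∞ M)
    (he' : e' ∈ IsManifold.maximalAtlas (𝓡 n) ∞ M) {p : Model n × Model n} (hp : p.1 ∈ e.target)
    (hp' : e.symm p.1 ∈ e'.source) :
    tangentLift (e' ∘ e.symm) p = chartCoords e' (chartVector e p) := by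
  rw [tangentLift, fderiv_chartChange he he' hp hp']
  rfl

theorem contMDiff_mk_tangentBundle : ContMDiff 𝓘(ℝ, Model n × Model n) (𝓡 n).tangent ∞
    (fun p : Model n × Model n => (⟨p.1, p.2⟩ : TangentBundle (𝓡 n) (Model n))) := by
  rw [modelWithCornersSelf_prod]
  exact contMDiff_tangentBundleModelSpaceHomeomorph_symm (I := 𝓡 n)

theorem contMDiff_toProd_tangentBundle : ContMDiff (𝓡 n).tangent 𝓘(ℝ, Model n × Model n) ∞
    (fun v : TangentBundle (𝓡 n) (Model n) => ((v.1, v.2) : Model n × Model n)) :=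
  ContMDiff.prodMk_space (Bundle.contMDiff_proj (TangentSpace (𝓡 n) (M := Model n)))
    (contMDiff_snd_tangentBundle_modelSpace (Model n) (𝓡 n))

variable [IsManifold (𝓡 n) ∞ M]

theorem contMDiffOn_chartVector (he : e ∈ IsManifold.maximalAtlas (𝓡 n) ∞ M) :
    ContMDiffOn 𝓘(ℝ, Model n × Model n) (𝓡 n).tangent ∞ (chartVector e)
      (slitDomain e.target) := by
  have h1 := (contMDiffOn_symm_of_mem_maximalAtlas he).contMDiffOn_tangentMapWithin (m := ∞)
    (by simp) e.open_target.uniqueMDiffOn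
  refine (h1.comp contMDiff_mk_tangentBundle.contMDiffOn (fun p hp => hp.1)).congr fun p hp => ?_
  -- Smoothness is available for the tangent map within the target; on an open set it agrees with
  -- the full one.
  exact (tangentMapWithin_eq_tangentMap (p := (⟨p.1, p.2⟩ : TangentBundle (𝓡 n) (Model n)))
    (e.open_target.uniqueMDiffOn _ hp.1)
    ((mdifferentiable_of_mem_maximalAtlas he).mdifferentiableAt_symm hp.1)).symm

theorem contMDiffOn_chartCoords (he : e ∈ IsManifold.maximalAtlas (𝓡 n) ∞ M) :
    ContMDiffOn (𝓡 n).tangent 𝓘(ℝ, Model n × Model n) ∞ (chartCoords e)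
      {v : TangentBundle (𝓡 n) M | v.1 ∈ e.source} := by
  have h1 := (contMDiffOn_of_mem_maximalAtlas he).contMDiffOn_tangentMapWithin (m := ∞)
    (by simp) e.open_source.uniqueMDiffOn
  refine ((contMDiff_toProd_tangentBundle.contMDiffOn (s := Set.univ)).comp h1
    (fun _ _ => Set.mem_univ _)).congr fun v hv => ?_
  have h2 := tangentMapWithin_eq_tangentMap (p := v) (e.open_source.uniqueMDiffOn _ hv)
    ((mdifferentiable_of_mem_maximalAtlas he).mdifferentiableAt hv)
  exact congrArg (fun w : TangentBundle (𝓡 n) (Model n) => ((w.1, w.2) : Model n × Model n)) h2.symm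

theorem IsFinsler.isLocalFinsler {F : TangentBundle (𝓡 n) M → ℝ} (hF : IsFinsler F)
    (he : e ∈ IsManifold.maximalAtlas (𝓡 n) ∞ M) : IsLocalFinsler e.target (localRep e F) := by
  refine IsLocalFinsler.of_homogeneous e.open_target ?_ (fun p => hF.nonneg _) ?_
    (fun p hp => hF.nondegenerate e he p.1 hp.1 p.2 hp.2)
  · exact contMDiffOn_iff_contDiffOn.1
      (hF.smooth.comp (contMDiffOn_chartVector he) fun p hp => chartVector_mem he hp)
  · intro x hx y hy c hc
    have h1 : chartVector e (x, c • y)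
        = ⟨e.symm x, c • mfderiv (𝓡 n) (𝓡 n) e.symm x y⟩ := by
      refine tangentBundle_ext rfl ?_
      exact map_smul (mfderiv (𝓡 n) (𝓡 n) e.symm x : Model n →L[ℝ] Model n) c y
    rw [localRep_apply, localRep_apply, h1]
    exact hF.homogeneous _ _ (chartVector_mem he (p := (x, y)) ⟨hx, hy⟩) c hc

/-! ### Gluing the local expressions to a function on the slit tangent bundle. -/

theorem lambdaCoord_chartChange (he : e ∈ IsManifold.maximalAtlas (𝓡 n) ∞ M)
    (he' : e' ∈ IsManifold.maximalAtlas (𝓡 n) ∞ M) {F : TangentBundle (𝓡 n) M → ℝ}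
    (hF : IsFinsler F) {v : TangentBundle (𝓡 n) M} (hv : v.1 ∈ e.source)
    (hv' : v.1 ∈ e'.source) (hv0 : v.2 ≠ 0) :
    lambdaCoord (localRep e F) (chartCoords e v)
      = lambdaCoord (localRep e' F) (chartCoords e' v) := by
  -- The image of the chart overlap under `e`, where the transition map `e' ∘ e.symm` is smooth with
  -- injective differential.
  set U : Set (Model n) := e.target ∩ e.symm ⁻¹' e'.source with hU
  have hUo : IsOpen U := e.symm.isOpen_inter_preimage e'.open_source
  have hmaps : Set.MapsTo (e' ∘ e.symm) U e'.target := fun x hx => e'.map_source hx.2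
  have hφ : ContDiffOn ℝ ∞ (e' ∘ e.symm) U := contMDiffOn_iff_contDiffOn.1
    ((contMDiffOn_of_mem_maximalAtlas he').comp
      ((contMDiffOn_symm_of_mem_maximalAtlas he).mono Set.inter_subset_left) fun x hx => hx.2)
  have hinj : ∀ x ∈ U, Function.Injective (fderiv ℝ (e' ∘ e.symm) x) := fun x hx => by
    rw [fderiv_chartChange he he' hx.1 hx.2]
    exact ((mdifferentiable_of_mem_maximalAtlas he').mfderiv_injective hx.2).comp
      ((mdifferentiable_of_mem_maximalAtlas he).symm.mfderiv_injective hx.1)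
  have hFF : ∀ q ∈ slitDomain U, localRep e F q = localRep e' F (tangentLift (e' ∘ e.symm) q) := by
    intro q hq
    rw [tangentLift_chartChange he he' hq.1.1 hq.1.2, localRep_apply, localRep_apply,
      chartVector_chartCoords he' (show (chartVector e q).1 ∈ e'.source from hq.1.2)]
  have hp : chartCoords e v ∈ slitDomain U := by
    have h1 := chartCoords_mem he hv hv0
    refine ⟨⟨h1.1, ?_⟩, h1.2⟩
    change e.symm (e v.1) ∈ e'.source
    rwa [e.left_inv hv]
  rw [lambdaCoord_tangentLift hφ hmaps hinj
    ((hF.isLocalFinsler he).mono hUo Set.inter_subset_left) (hF.isLocalFinsler he') hFF hp,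
    tangentLift_chartChange he he' hp.1.1 hp.1.2, chartVector_chartCoords he hv]

/-- The function `λ` on the tangent bundle. -/
def lambdaFunction (F : TangentBundle (𝓡 n) M → ℝ) : TangentBundle (𝓡 n) M → ℝ :=
  fun v => lambdaCoord (localRep (chartAt (Model n) v.1) F) (chartCoords (chartAt (Model n) v.1) v)

theorem IsFinsler.lambdaFunction_eq {F : TangentBundle (𝓡 n) M → ℝ} (hF : IsFinsler F)
    (he : e ∈ IsManifold.maximalAtlas (𝓡 n) ∞ M) {v : TangentBundle (𝓡 n) M}
    (hv : v.1 ∈ e.source) (hv0 : v.2 ≠ 0) :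
    lambdaFunction F v = lambdaCoord (localRep e F) (chartCoords e v) :=
  lambdaCoord_chartChange (IsManifold.chart_mem_maximalAtlas v.1) he hF (mem_chart_source _ _)
    hv hv0

theorem IsFinsler.localRep_lambdaFunction {F : TangentBundle (𝓡 n) M → ℝ} (hF : IsFinsler F)
    (he : e ∈ IsManifold.maximalAtlas (𝓡 n) ∞ M) {p : Model n × Model n}
    (hp : p ∈ slitDomain e.target) :
    localRep e (lambdaFunction F) p = lambdaCoord (localRep e F) p := by
  rw [localRep_apply, hF.lambdaFunction_eq he (e.map_target hp.1) (chartVector_mem he hp),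
    chartCoords_chartVector he hp.1]

theorem IsFinsler.contMDiffOn_lambdaFunction {F : TangentBundle (𝓡 n) M → ℝ} (hF : IsFinsler F) :
    ContMDiffOn (𝓡 n).tangent 𝓘(ℝ) ∞ (lambdaFunction F) (slitTangentBundle n M) := by
  intro v hv
  set e := chartAt (Model n) v.1
  have he : e ∈ IsManifold.maximalAtlas (𝓡 n) ∞ M := IsManifold.chart_mem_maximalAtlas v.1
  have hopen : IsOpen {w : TangentBundle (𝓡 n) M | w.1 ∈ e.source} :=
    e.open_source.preimage (FiberBundle.continuous_proj (Model n) (TangentSpace (𝓡 n) (M := M)))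
  have hve : v.1 ∈ e.source := mem_chart_source _ _
  -- The chart in `lambdaFunction` varies with the base point; chart independence replaces it near
  -- `v` by the single chart `e`.
  have h1 : ContMDiffOn (𝓡 n).tangent 𝓘(ℝ) ∞ (lambdaFunction F)
      (slitTangentBundle n M ∩ {w : TangentBundle (𝓡 n) M | w.1 ∈ e.source}) :=
    ((hF.isLocalFinsler he).contDiffOn_lambdaCoord.contMDiffOn.comp
      ((contMDiffOn_chartCoords he).mono Set.inter_subset_right)
      fun w hw => chartCoords_mem he hw.2 hw.1).congr
        fun w hw => hF.lambdaFunction_eq he hw.2 hw.1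
  exact (h1 v ⟨hv, hve⟩).mono_of_mem_nhdsWithin
    (Filter.inter_mem self_mem_nhdsWithin (mem_nhdsWithin_of_mem_nhds (hopen.mem_nhds hve)))

end Manifold

end Finsler

end

/-- The rank condition on the mean Berwald curvature is not needed for the conclusion: it only
ensures that `λ` does not vanish. -/
theorem theorem1 {n : ℕ} (hn : 1 < n)
    {M : Type*} [TopologicalSpace M] [ChartedSpace (Finsler.Model n) M]
    [IsManifold (𝓡 n) ∞ M]
    (F : TangentBundle (𝓡 n) M → ℝ) (hF : Finsler.IsFinsler F)
    (hχ : Finsler.InAllCoordinates (M := M) fun e p =>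
      ∀ j, Finsler.chiCurvature (Finsler.localRep e F) j p = 0)
    (hE : Finsler.InAllCoordinates (M := M) fun e p =>
      (Finsler.meanBerwald (Finsler.localRep e F) p).rank = n - 1) :
    ∃ lam : TangentBundle (𝓡 n) M → ℝ,
      (Finsler.InAllCoordinates (M := M) fun e p =>
        Finsler.localRep e lam p = Finsler.lambdaCoord (Finsler.localRep e F) p) ∧
      Finsler.IsFirstIntegral F lam := by
  refine ⟨Finsler.lambdaFunction F, fun e he x hx y hy =>
    hF.localRep_lambdaFunction he (p := (x, y)) ⟨hx, hy⟩, hF.contMDiffOn_lambdaFunction, ?_⟩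
  intro e he x hx y hy
  have hp : (x, y) ∈ Finsler.slitDomain e.target := ⟨hx, hy⟩
  have h := hF.isLocalFinsler he
  have h1 := h.spray_lambdaCoord (fun q hq => hχ e he q.1 hq.1 q.2 hq.2) hp
  rw [Finsler.spray, Finsler.secondOrderField_eq_dirDeriv] at h1 ⊢
  rw [← h1]
  -- The spray differentiates, so the coordinate expression must agree with `lambdaCoord` on an open
  -- set, not just at the point.
  exact Finsler.dirDeriv_congr h.isOpen_domain
    (fun q hq => hF.localRep_lambdaFunction he hq) hp _
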